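/- Let $N\ge 1$ and $n\ge 1$ be integers. Let $J^\infty E$ be the infinite jet space of the trivial bundle $E=\mathbf R^N\times\mathbf R\to\mathbf R^N$, with coordinates $(x^i,u_J)$, where $1\le i\le N$ and $J=(j_1,\dots,j_N)$ runs over all multi-indices of non-negative integers, of order $|J|=j_1+\dots+j_N$. Let $\mathrm{Loc}(E)$ be the real vector space of local functions, i.e. functions on $J^\infty E$ that are pullbacks of smooth functions of the coordinates $x^i$, $u_J$ with $|J|\le k$, for some $k$. Let $\frac{d}{dx^i}=\frac{\partial}{\partial x^i}+\sum_J u_{iJ}\frac{\partial}{\partial u_J}$ be the total derivatives, where $iJ$ is $J$ with $j_i$ replaced by $j_i+1$, and write $\left(\frac{d}{d\mathbf x}\right)^I=\prod_{l=1}^N\left(\frac{d}{dx^l}\right)^{i_l}$ for a multi-index $I=(i_1,\dots,i_N)$. For a finitely supported function $\alpha$ from multi-indices to non-negative integers put $\left(\frac{\partial}{\partial\mathbf u}\right)^\alpha=\prod_J\left(\frac{\partial}{\partial u_J}\right)^{\alpha(J)}$, and let $\deg_f(\alpha)$ be the maximal $|J|$ with $\alpha(J)\ne0$ (and $0$ if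 $\alpha=0$). Let $\mathrm{LDO}(n)$ be the real vector space of $n$-linear maps $A:\mathrm{Loc}(E)^{\otimes n}\to\mathrm{Loc}(E)$ of the form $$A(f_1,\dots,f_n)=\sum p_{I_1,\dots,I_n;\alpha_1,\dots,\alpha_n}\prod_{j=1}^n\left(\frac{d}{d\mathbf x}\right)^{I_j}\left(\frac{\partial}{\partial\mathbf u}\right)^{\alpha_j}f_j ,$$ with coefficients $p_{I;\alpha}\in\mathrm{Loc}(E)$ such that $(*)$ for every $m$ only finitely many of the coefficients with $\sum_j\deg_f(\alpha_j)\le m$ are non-zero. Let $\frac{d}{dx^i_j}$, $\left(\frac{\partial}{\partial\mathbf u_j}\right)^{\alpha}$ denote the operators acting on the $j$-th argument, and put $\frac{d}{dy_1^i}=\frac{d}{dx_1^i}+\dots+\frac{d}{dx_n^i}$ and $\frac{d}{dy_j^i}=\frac{d}{dx_j^i}$ for $2\le j\le n$. Then every $A\in\mathrm{LDO}(n)$ can be written in exactly one way in the polarized form $$A=\sum q_{I_1,\dots,I_n;\alpha_1,\dots,\alpha_n}\left(\frac{d}{d\mathbf y_1}\right)^{I_1}\cdots\left(\frac{d}{d\mathbf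 y_n}\right)^{I_n}\left(\frac{\partial}{\partial\mathbf u_1}\right)^{\alpha_1}\cdots\left(\frac{\partial}{\partial\mathbf u_n}\right)^{\alpha_n}$$ with coefficients $q_{I;\alpha}\in\mathrm{Loc}(E)$ satisfying $(*)$, and its characteristic $\chi(A)\in\mathrm{LDO}(n)$ is defined by $$\chi(A)=\sum(-1)^{|I_1|}\left(\left(\frac{d}{d\mathbf x}\right)^{I_1}q_{I_1,\dots,I_n;\alpha_1,\dots,\alpha_n}\right)\left(\frac{d}{d\mathbf y_2}\right)^{I_2}\cdots\left(\frac{d}{d\mathbf y_n}\right)^{I_n}\left(\frac{\partial}{\partial\mathbf u_1}\right)^{\alpha_1}\cdots\left(\frac{\partial}{\partial\mathbf u_n}\right)^{\alpha_n}.$$ Let $O^k(n)$, $0\le k\le N$, be the space of forms $\sum_{|\epsilon|=k}A_\epsilon(d\mathbf x)^\epsilon$ with $A_\epsilon\in\mathrm{LDO}(n)$, where $(d\mathbf x)^\epsilon=(dx^1)^{\epsilon^1}\wedge\dots\wedge(dx^N)^{\epsilon^N}$, $\epsilon\in\{0,1\}^N$, with the differential $$d\bigl(A(d\mathbf x)^\epsilon\bigr)=\sum_{i=1}^N\Bigl(\frac{d}{dx^i}\circ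 A\Bigr)\,dx^i\wedge(d\mathbf x)^\epsilon ,$$ and let $J:O^N(n)\to\mathrm{LDO}(n)$ be the map $J(A\,dx^1\wedge\dots\wedge dx^N)=A$. Then: 1. $H^k(O^*(n),d)=0$ for all $k<N$. 2. $\{A\in\mathrm{LDO}(n):\chi(A)=0\}$ is a linear subspace of $\mathrm{LDO}(n)$, and $J$ induces an isomorphism of real vector spaces $$H^N(O^*(n),d)\;\cong\;\frac{\mathrm{LDO}(n)}{\{A\in\mathrm{LDO}(n):\chi(A)=0\}} .$$ 3. In particular, if $A\in\mathrm{LDO}(n)$ satisfies $\frac{d}{dx^i}\circ A=0$ for all $1\le i\le N$, then $A=0$. -/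

import Mathlib

noncomputable section

open scoped ContDiff TensorProduct

namespace OpComplex

/-- Multi-indices `J = (j₁, …, j_N)`; the order of `J` is `∑ i, J i`. -/
abbrev MIdx (N : ℕ) : Type := Fin N → ℕ

/-- The finitely many multi-indices of order at most `k`. -/
def midx (N k : ℕ) : Finset (MIdx N) :=
  (Finset.Iic (fun _ => k)).filter (fun J => ∑ i, J i ≤ k)

theorem mem_midx {N k : ℕ} {J : MIdx N} : J ∈ midx N k ↔ ∑ i, J i ≤ k := by
  simp only [midx, Finset.mem_filter, Finset.mem_Iic, and_iff_right_iff_imp]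
  exact fun h i => (Finset.single_le_sum (fun _ _ => Nat.zero_le _) (Finset.mem_univ i)).trans h

/-- `iJ = (j₁, …, jᵢ + 1, …, j_N)`. -/
def MIdx.up {N : ℕ} (i : Fin N) (J : MIdx N) : MIdx N := J + Pi.single i 1

theorem MIdx.sum_up {N : ℕ} (i : Fin N) (J : MIdx N) : ∑ l, MIdx.up i J l = ∑ l, J l + 1 := by
  simp [MIdx.up, Finset.sum_add_distrib]

/-- The infinite jet space of `ℝ^N × ℝ → ℝ^N`, a point being `(x, u)` with `x = (xⁱ)` and
`u = (u_J)`. -/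
abbrev Jet (N : ℕ) : Type := (Fin N → ℝ) × (MIdx N → ℝ)

/-- The finite jet space `J^k E`. -/
abbrev FinJet (N k : ℕ) : Type := (Fin N → ℝ) × (midx N k → ℝ)

/-- The projection `J^∞ E → J^k E`. -/
def proj (N k : ℕ) : Jet N →ₗ[ℝ] FinJet N k where
  toFun p := (p.1, fun J => p.2 J)
  map_add' _ _ := rfl
  map_smul' _ _ := rfl

/-- `f` is the pullback of a smooth function on `J^k E`. -/
def IsLocalOfOrder (N k : ℕ) (f : Jet N → ℝ) : Prop :=
  ∃ g : FinJet N k → ℝ, ContDiff ℝ ∞ g ∧ ∀ p, f p = g (proj N k p)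

/-- The projection `J^l E → J^k E` for `k ≤ l`. -/
def res {N k l : ℕ} (h : k ≤ l) : FinJet N l →L[ℝ] FinJet N k :=
  LinearMap.toContinuousLinearMap
    { toFun := fun y => (y.1, fun J => y.2 ⟨J, mem_midx.2 ((mem_midx.1 J.2).trans h)⟩)
      map_add' := fun _ _ => rfl
      map_smul' := fun _ _ => rfl }

theorem IsLocalOfOrder.mono {N k l : ℕ} {f : Jet N → ℝ} (h : k ≤ l) (hf : IsLocalOfOrder N k f) :
    IsLocalOfOrder N l f := by
  obtain ⟨g, hg, hfg⟩ := hf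
  exact ⟨g ∘ res h, hg.comp (res h).contDiff, fun p => hfg p⟩

/-- `Loc(E)`: the algebra of local functions. -/
def Loc (N : ℕ) : Subalgebra ℝ (Jet N → ℝ) where
  carrier := {f | ∃ k, IsLocalOfOrder N k f}
  mul_mem' := by
    rintro a b ⟨k, ha⟩ ⟨l, hb⟩
    obtain ⟨g, hg, hag⟩ := ha.mono (le_max_left k l)
    obtain ⟨g', hg', hbg⟩ := hb.mono (le_max_right k l)
    exact ⟨max k l, fun y => g y * g' y, hg.mul hg', fun p => by simp [hag, hbg]⟩
  add_mem' := by
    rintro a b ⟨k, ha⟩ ⟨l, hb⟩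
    obtain ⟨g, hg, hag⟩ := ha.mono (le_max_left k l)
    obtain ⟨g', hg', hbg⟩ := hb.mono (le_max_right k l)
    exact ⟨max k l, fun y => g y + g' y, hg.add hg', fun p => by simp [hag, hbg]⟩
  algebraMap_mem' r := ⟨0, fun _ => r, contDiff_const, fun _ => rfl⟩

/-- `∂f/∂xⁱ`, the coordinates `u_J` being fixed. -/
def partialX {N : ℕ} (i : Fin N) (f : Jet N → ℝ) : Jet N → ℝ :=
  fun p => lineDeriv ℝ f p (Pi.single i 1, 0)

/-- `∂f/∂u_J`. -/
def partialU {N : ℕ} (J : MIdx N) (f : Jet N → ℝ) : Jet N → ℝ :=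
  fun p => lineDeriv ℝ f p (0, Pi.single J 1)

/-- The total derivative `df/dxⁱ = ∂f/∂xⁱ + ∑_J u_{iJ} ∂f/∂u_J`; the sum is finite if `f` is
local. -/
def totalD {N : ℕ} (i : Fin N) (f : Jet N → ℝ) : Jet N → ℝ :=
  fun p => partialX i f p + ∑ᶠ J : MIdx N, p.2 (MIdx.up i J) * partialU J f p

theorem lineDeriv_local {N k : ℕ} {f : Jet N → ℝ} {g : FinJet N k → ℝ} (hg : ContDiff ℝ ∞ g)
    (hfg : ∀ p, f p = g (proj N k p)) (p v : Jet N) :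
    lineDeriv ℝ f p v = fderiv ℝ g (proj N k p) (proj N k v) := by
  have h1 : HasLineDerivAt ℝ g (fderiv ℝ g (proj N k p) (proj N k v)) (proj N k p)
      (proj N k v) := ((hg.differentiable (by simp)) _).hasFDerivAt.hasLineDerivAt _
  have h2 : HasLineDerivAt ℝ f (fderiv ℝ g (proj N k p) (proj N k v)) p v := by
    unfold HasLineDerivAt at h1 ⊢
    simpa [hfg] using h1
  exact h2.lineDeriv

theorem partialU_eq_zero {N k : ℕ} {f : Jet N → ℝ} (hf : IsLocalOfOrder N k f) {J : MIdx N}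
    (hJ : k < ∑ i, J i) : partialU J f = 0 := by
  obtain ⟨g, hg, hfg⟩ := hf
  funext p
  have : proj N k (0, Pi.single J 1) = 0 := by
    ext K
    · rfl
    · have : (K : MIdx N) ≠ J := fun h => absurd (mem_midx.1 K.2) (by rw [h]; omega)
      simp [proj, this]
  simp [partialU, lineDeriv_local hg hfg, this]

theorem IsLocalOfOrder.lineDeriv {N k : ℕ} {f : Jet N → ℝ} (hf : IsLocalOfOrder N k f)
    (v : Jet N) : IsLocalOfOrder N k (fun p => lineDeriv ℝ f p v) := by
  obtain ⟨g, hg, hfg⟩ := hf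
  refine ⟨fun y => fderiv ℝ g y (proj N k v), ?_, fun p => lineDeriv_local hg hfg p v⟩
  exact (hg.fderiv_right (m := ∞) (by simp)).clm_apply contDiff_const

/-- The vector `d/dxⁱ` at a jet. -/
def totalVec {N : ℕ} (i : Fin N) (p : Jet N) : Jet N :=
  (Pi.single i 1, fun J => p.2 (MIdx.up i J))

theorem totalD_local {N k : ℕ} {f : Jet N → ℝ} {g : FinJet N k → ℝ} (hg : ContDiff ℝ ∞ g)
    (hfg : ∀ p, f p = g (proj N k p)) (i : Fin N) (p : Jet N) :
    totalD i f p = fderiv ℝ g (proj N k p) (proj N k (totalVec i p)) := by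
  have h0 : (Function.support fun J : MIdx N => p.2 (MIdx.up i J) * partialU J f p) ⊆
      midx N k := by
    intro J hJ
    by_contra h
    rw [Finset.mem_coe, mem_midx, not_le] at h
    exact hJ (by simp [partialU_eq_zero ⟨g, hg, hfg⟩ h])
  have h1 : proj N k (totalVec i p) = proj N k (Pi.single i 1, 0) +
      ∑ J ∈ midx N k, p.2 (MIdx.up i J) • proj N k (0, Pi.single J 1) := by
    refine Prod.ext ?_ ?_
    · simp [proj, totalVec, Prod.fst_sum]
    · funext K
      have : (K : MIdx N) ∈ midx N k := K.2
      simp [proj, totalVec, Prod.snd_sum, Pi.single_apply]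
  rw [totalD, finsum_eq_sum_of_support_subset _ h0, h1]
  simp [partialX, partialU, lineDeriv_local hg hfg]

/-- The linear part of `totalVec` on finite jets. -/
def shiftL {N : ℕ} (k : ℕ) (i : Fin N) : FinJet N (k + 1) →L[ℝ] FinJet N k :=
  LinearMap.toContinuousLinearMap
    { toFun := fun y => (0, fun J => y.2 ⟨MIdx.up i J, mem_midx.2 (by
        rw [MIdx.sum_up]; exact Nat.succ_le_succ (mem_midx.1 J.2))⟩)
      map_add' := fun _ _ => by ext <;> simp
      map_smul' := fun _ _ => by ext <;> simp }

theorem proj_totalVec {N : ℕ} (k : ℕ) (i : Fin N) (p : Jet N) :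
    proj N k (totalVec i p) = (Pi.single i 1, 0) + shiftL k i (proj N (k + 1) p) := by
  ext <;> simp [proj, totalVec, shiftL]

/-- The function on `J^{k+1} E` that represents the total derivative of `g`. -/
def totalRep {N k : ℕ} (i : Fin N) (g : FinJet N k → ℝ) (y : FinJet N (k + 1)) : ℝ :=
  fderiv ℝ g (res (Nat.le_succ k) y) ((Pi.single i 1, 0) + shiftL k i y)

theorem contDiff_totalRep {N k : ℕ} (i : Fin N) {g : FinJet N k → ℝ} (hg : ContDiff ℝ ∞ g) :
    ContDiff ℝ ∞ (totalRep i g) := by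
  unfold totalRep
  have := hg.fderiv_right (m := ∞) (by simp)
  fun_prop

theorem totalD_rep {N k : ℕ} {f : Jet N → ℝ} {g : FinJet N k → ℝ} (hg : ContDiff ℝ ∞ g)
    (hfg : ∀ p, f p = g (proj N k p)) (i : Fin N) (p : Jet N) :
    totalD i f p = totalRep i g (proj N (k + 1) p) := by
  rw [totalD_local hg hfg, proj_totalVec]; rfl

theorem IsLocalOfOrder.totalD {N k : ℕ} {f : Jet N → ℝ} (hf : IsLocalOfOrder N k f)
    (i : Fin N) : IsLocalOfOrder N (k + 1) (totalD i f) := by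
  obtain ⟨g, hg, hfg⟩ := hf
  exact ⟨totalRep i g, contDiff_totalRep i hg, totalD_rep hg hfg i⟩

theorem totalD_comm {N : ℕ} {f : Jet N → ℝ} (hf : f ∈ Loc N) (i j : Fin N) :
    totalD i (totalD j f) = totalD j (totalD i f) := by
  obtain ⟨k, g, hg, hfg⟩ := hf
  have hg' : Differentiable ℝ (fderiv ℝ g) :=
    (hg.fderiv_right (m := ∞) (by simp)).differentiable (by simp)
  have key : ∀ (i j : Fin N) (p : Jet N), OpComplex.totalD i (OpComplex.totalD j f) p =
      fderiv ℝ (fderiv ℝ g) (proj N k p) (proj N k (totalVec i p)) (proj N k (totalVec j p)) +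
      fderiv ℝ g (proj N k p) (0, fun J => p.2 (MIdx.up i (MIdx.up j J))) := by
    intro i j p
    rw [totalD_local (contDiff_totalRep j hg) (totalD_rep hg hfg j)]
    have h1 : HasFDerivAt (fun y : FinJet N (k + 1) => fderiv ℝ g (res (Nat.le_succ k) y)) _
        (proj N (k + 1) p) :=
      ((hg' (res (Nat.le_succ k) (proj N (k + 1) p))).hasFDerivAt).comp _
        (res (Nat.le_succ k)).hasFDerivAt
    have h2 : HasFDerivAt (fun y : FinJet N (k + 1) =>
        ((Pi.single j 1, 0) : FinJet N k) + shiftL k j y) (shiftL k j) (proj N (k + 1) p) :=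
      (shiftL k j).hasFDerivAt.const_add _
    have h3 := (h1.clm_apply h2).fderiv
    change fderiv ℝ (fun y => fderiv ℝ g (res (Nat.le_succ k) y)
      ((Pi.single j 1, 0) + shiftL k j y)) _ _ = _
    rw [h3, ← proj_totalVec]
    simp only [add_apply, ContinuousLinearMap.comp_apply,
      ContinuousLinearMap.flip_apply]
    rw [add_comm]
    rfl
  funext p
  rw [key, key]
  have hs : IsSymmSndFDerivAt ℝ g (proj N k p) :=
    (hg.contDiffAt).isSymmSndFDerivAt (by simp; exact WithTop.coe_le_coe.2 (le_top : (2:ℕ∞) ≤ ⊤))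
  rw [hs.eq]
  congr 3
  funext J
  exact congrArg p.2 (add_right_comm (J : MIdx N) (Pi.single j 1) (Pi.single i 1))

theorem lineDeriv_comm {N : ℕ} {f : Jet N → ℝ} (hf : f ∈ Loc N) (v w p : Jet N) :
    lineDeriv ℝ (fun q => lineDeriv ℝ f q w) p v =
      lineDeriv ℝ (fun q => lineDeriv ℝ f q v) p w := by
  obtain ⟨k, g, hg, hfg⟩ := hf
  have hg1 := hg.fderiv_right (m := ∞) (by simp)
  have hg' : Differentiable ℝ (fderiv ℝ g) := hg1.differentiable (by simp)
  have key : ∀ v w : Jet N, lineDeriv ℝ (fun q => lineDeriv ℝ f q w) p v =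
      fderiv ℝ (fderiv ℝ g) (proj N k p) (proj N k v) (proj N k w) := by
    intro v w
    rw [lineDeriv_local (g := fun y => fderiv ℝ g y (proj N k w))
      (hg1.clm_apply contDiff_const) (fun q => lineDeriv_local hg hfg q w)]
    rw [((hg' _).hasFDerivAt.clm_apply (hasFDerivAt_const (proj N k w) _)).fderiv]
    simp
  have hs : IsSymmSndFDerivAt ℝ g (proj N k p) :=
    (hg.contDiffAt).isSymmSndFDerivAt (by simp; exact WithTop.coe_le_coe.2 (le_top : (2:ℕ∞) ≤ ⊤))
  rw [key, key, hs.eq]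

/-- `∂/∂u_J` as an operator on local functions. -/
def dU {N : ℕ} (J : MIdx N) : Module.End ℝ (Loc N) where
  toFun f := ⟨partialU J f, f.2.imp fun _ h => h.lineDeriv _⟩
  map_add' := by
    rintro ⟨a, k, ha⟩ ⟨b, l, hb⟩
    obtain ⟨g, hg, hag⟩ := ha.mono (le_max_left k l)
    obtain ⟨g', hg', hbg⟩ := hb.mono (le_max_right k l)
    refine Subtype.ext (funext fun p => ?_)
    have h3 := lineDeriv_local (f := a + b) (hg.add hg')
      (fun p => by simp [hag, hbg]) p (0, Pi.single J 1)
    rw [fderiv_fun_add (hg.differentiable (by simp) _) (hg'.differentiable (by simp) _)] at h3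
    simpa [partialU, lineDeriv_local hg hag, lineDeriv_local hg' hbg] using h3
  map_smul' := by
    rintro r ⟨a, k, g, hg, hag⟩
    refine Subtype.ext (funext fun p => ?_)
    have h3 := lineDeriv_local (f := r • a) (hg.const_smul r)
      (fun p => by simp [hag]) p (0, Pi.single J 1)
    rw [fderiv_fun_const_smul (hg.differentiable (by simp) _)] at h3
    simpa [partialU, lineDeriv_local hg hag] using h3

/-- `d/dxⁱ` as an operator on local functions. -/
def dX {N : ℕ} (i : Fin N) : Module.End ℝ (Loc N) where
  toFun f := ⟨totalD i f, f.2.elim fun k h => ⟨k + 1, h.totalD i⟩⟩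
  map_add' := by
    rintro ⟨a, k, ha⟩ ⟨b, l, hb⟩
    obtain ⟨g, hg, hag⟩ := ha.mono (le_max_left k l)
    obtain ⟨g', hg', hbg⟩ := hb.mono (le_max_right k l)
    refine Subtype.ext (funext fun p => ?_)
    have h3 := totalD_local (f := a + b) (hg.add hg') (fun p => by simp [hag, hbg]) i p
    rw [fderiv_fun_add (hg.differentiable (by simp) _) (hg'.differentiable (by simp) _)] at h3
    simpa [totalD_local hg hag, totalD_local hg' hbg] using h3
  map_smul' := by
    rintro r ⟨a, k, g, hg, hag⟩
    refine Subtype.ext (funext fun p => ?_)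
    have h3 := totalD_local (f := r • a) (hg.const_smul r) (fun p => by simp [hag]) i p
    rw [fderiv_fun_const_smul (hg.differentiable (by simp) _)] at h3
    simpa [totalD_local hg hag] using h3

theorem dX_mul {N : ℕ} (i : Fin N) (a b : Loc N) : dX i (a * b) = dX i a * b + a * dX i b := by
  obtain ⟨a, k, ha⟩ := a
  obtain ⟨b, l, hb⟩ := b
  obtain ⟨g, hg, hag⟩ := ha.mono (le_max_left k l)
  obtain ⟨g', hg', hbg⟩ := hb.mono (le_max_right k l)
  refine Subtype.ext (funext fun p => ?_)
  have h3 := totalD_local (f := a * b) (hg.mul hg') (fun p => by simp [hag, hbg]) i p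
  rw [fderiv_fun_mul (hg.differentiable (by simp) _) (hg'.differentiable (by simp) _)] at h3
  simp only [add_apply, smul_apply, smul_eq_mul,
    ← totalD_local hg hag, ← totalD_local hg' hbg, ← hag, ← hbg] at h3
  refine h3.trans ?_
  change _ = totalD i a p * b p + a p * totalD i b p
  ring

theorem dX_commute {N : ℕ} (i j : Fin N) : Commute (dX i) (dX j) :=
  LinearMap.ext fun f => Subtype.ext (totalD_comm f.2 i j)

theorem dU_commute {N : ℕ} (J K : MIdx N) : Commute (dU J) (dU K) :=
  LinearMap.ext fun f => Subtype.ext (funext fun p => lineDeriv_comm f.2 _ _ p)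

theorem dX_pow_commute {N : ℕ} (I K : MIdx N) (s : Set (Fin N)) :
    (s.Pairwise fun i j => Commute (dX i ^ I i) (dX j ^ K j)) :=
  fun i _ j _ _ => (dX_commute i j).pow_pow (I i) (K j)

theorem dX_pow_commute' {N : ℕ} (I : MIdx N) (s : Set (Fin N)) :
    s.Pairwise (Function.onFun Commute fun i => dX i ^ I i) :=
  dX_pow_commute I I s

/-- `(d/dx)^I = (d/dx¹)^{i₁} ⋯ (d/dx^N)^{i_N}` on local functions. -/
def dXPow {N : ℕ} (I : MIdx N) : Module.End ℝ (Loc N) :=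
  Finset.univ.noncommProd (fun i => dX i ^ I i) (dX_pow_commute' I _)

theorem dX_mul_dXPow {N : ℕ} (i : Fin N) (I : MIdx N) : dX i * dXPow I = dXPow (MIdx.up i I) := by
  have h1 : dXPow (Pi.single i 1) = dX i := by
    rw [dXPow, ← Finset.mul_noncommProd_erase _ (Finset.mem_univ i)]
    rw [Finset.noncommProd_eq_pow_card (Finset.univ.erase i) _
      (fun a _ b _ _ => (dX_commute a b).pow_pow _ _) 1]
    · simp
    · intro j hj
      simp [Finset.ne_of_mem_erase hj]
  have h := Finset.noncommProd_mul_distrib (s := Finset.univ)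
    (fun j => (dX j : Module.End ℝ (Loc N)) ^ (Pi.single i 1 : MIdx N) j) (fun j => dX j ^ I j)
    (dX_pow_commute' _ _) (dX_pow_commute' _ _) (dX_pow_commute _ _ _)
  change _ = dXPow (Pi.single i 1) * dXPow I at h
  rw [← h1, ← h]
  refine Finset.noncommProd_congr rfl (fun j _ => ?_) _
  simp [MIdx.up, ← pow_add, add_comm]

/-- The exponents `α` of monomials in the vertical derivatives: finitely supported functions on
the multi-indices, with values in the nonnegative integers. -/
abbrev VIdx (N : ℕ) : Type := MIdx N →₀ ℕ

/-- The formal differential degree `deg_f α`: the maximal order of a `J` with `α(J) ≠ 0`. -/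
def VIdx.deg {N : ℕ} (α : VIdx N) : ℕ := α.support.sup (fun J => ∑ i, J i)

theorem dU_pow_commute {N : ℕ} (α : VIdx N) (s : Set (MIdx N)) :
    s.Pairwise (Function.onFun Commute fun J => dU J ^ α J) :=
  fun J _ K _ _ => (dU_commute J K).pow_pow (α J) (α K)

/-- `(∂/∂u)^α = ∏_J (∂/∂u_J)^{α(J)}` on local functions. -/
def dUPow {N : ℕ} (α : VIdx N) : Module.End ℝ (Loc N) :=
  α.support.noncommProd (fun J => dU J ^ α J) (dU_pow_commute α _)

theorem dUPow_eq_zero {N k : ℕ} {f : Loc N} (hf : IsLocalOfOrder N k f) {α : VIdx N}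
    (hα : k < α.deg) : dUPow α f = 0 := by
  obtain ⟨J, hJ, hk⟩ := Finset.lt_sup_iff.1 hα
  rw [dUPow, ← Finset.noncommProd_erase_mul _ hJ, Module.End.mul_apply]
  obtain ⟨m, hm⟩ := Nat.exists_eq_succ_of_ne_zero (Finsupp.mem_support_iff.1 hJ)
  have : dU J f = 0 := Subtype.ext (partialU_eq_zero hf hk)
  simp [hm, pow_succ, this]

/-- `Loc(E)^{⊗n}`. -/
abbrev LocT (N n : ℕ) : Type := ⨂[ℝ] _ : Fin n, Loc N

/-- The multiplication `f₁ ⊗ ⋯ ⊗ f_n ↦ f₁ ⋯ f_n`. -/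
def mulT (N n : ℕ) : LocT N n →ₗ[ℝ] Loc N :=
  PiTensorProduct.lift (MultilinearMap.mkPiAlgebra ℝ (Fin n) (Loc N))

/-- `(∂/∂u₁)^{α₁} ⋯ (∂/∂u_n)^{α_n}` on `Loc(E)^{⊗n}`. -/
def dUT {N n : ℕ} (α : Fin n → VIdx N) : Module.End ℝ (LocT N n) :=
  PiTensorProduct.map (fun j => dUPow (α j))

/-- `(d/dx₁)^{I₁} ⋯ (d/dx_n)^{I_n}` on `Loc(E)^{⊗n}`. -/
def dXT {N n : ℕ} (I : Fin n → MIdx N) : Module.End ℝ (LocT N n) :=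
  PiTensorProduct.map (fun j => dXPow (I j))

/-- `d/dxⁱ_j`: the total derivative `d/dxⁱ` acting on the `j`-th tensor factor. -/
def dXSlot {N n : ℕ} (j : Fin n) (i : Fin N) : Module.End ℝ (LocT N n) :=
  PiTensorProduct.map (Function.update (fun _ => LinearMap.id) j (dX i))

theorem dXSlot_commute {N n : ℕ} (j k : Fin n) (i l : Fin N) :
    Commute (dXSlot j i) (dXSlot k l) := by
  unfold dXSlot
  rw [commute_iff_eq, ← PiTensorProduct.map_mul, ← PiTensorProduct.map_mul]
  congr 1
  funext m
  by_cases hj : m = j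
  · subst hj
    by_cases hk : m = k
    · subst hk
      simpa using (dX_commute i l).eq
    · ext; simp [Function.update_of_ne hk]
  · ext; simp [Function.update_of_ne hj]

/-- `d/dyⁱ_j`: for the first index this is `d/dxⁱ_1 + ⋯ + d/dxⁱ_n`, for the other indices it is
`d/dxⁱ_j`. -/
def dYSlot {N n : ℕ} [NeZero n] (j : Fin n) (i : Fin N) : Module.End ℝ (LocT N n) :=
  if j = 0 then ∑ k, dXSlot k i else dXSlot j i

theorem dYSlot_commute {N n : ℕ} [NeZero n] (j k : Fin n) (i l : Fin N) :
    Commute (dYSlot j i) (dYSlot k l) := by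
  unfold dYSlot
  split_ifs
  · exact Commute.sum_left _ _ _ fun a _ => Commute.sum_right _ _ _ fun b _ => dXSlot_commute ..
  · exact Commute.sum_left _ _ _ fun a _ => dXSlot_commute ..
  · exact Commute.sum_right _ _ _ fun a _ => dXSlot_commute ..
  · exact dXSlot_commute ..

theorem dYSlot_pow_commute {N n : ℕ} [NeZero n] (I : Fin n → MIdx N) (s : Set (Fin n × Fin N)) :
    s.Pairwise (Function.onFun Commute fun a => dYSlot a.1 a.2 ^ I a.1 a.2) :=
  fun a _ b _ _ => (dYSlot_commute a.1 b.1 a.2 b.2).pow_pow _ _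

/-- `(d/dy₁)^{I₁} ⋯ (d/dy_n)^{I_n}` on `Loc(E)^{⊗n}`. -/
def dYT {N n : ℕ} [NeZero n] (I : Fin n → MIdx N) : Module.End ℝ (LocT N n) :=
  (Finset.univ : Finset (Fin n × Fin N)).noncommProd (fun a => dYSlot a.1 a.2 ^ I a.1 a.2)
    (dYSlot_pow_commute I _)

/-- The index set `(I₁, …, I_n; α₁, …, α_n)` of the coefficients. -/
abbrev CIdx (N n : ℕ) : Type := (Fin n → MIdx N) × (Fin n → VIdx N)

/-- Coefficient systems `p_{I₁,…,I_n;α₁,…,α_n}` in `Loc(E)` such that for each `m` only finitely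
many of them with `∑ deg_f αⱼ ≤ m` are nonzero. -/
def Coeff (N n : ℕ) : Submodule ℝ (CIdx N n → Loc N) where
  carrier := {p | ∀ m : ℕ, {c : CIdx N n | ∑ j, (c.2 j).deg ≤ m ∧ p c ≠ 0}.Finite}
  zero_mem' m := by simp
  add_mem' {p q} hp hq m := by
    refine ((hp m).union (hq m)).subset fun c hc => ?_
    by_cases h : p c = 0
    · exact Or.inr ⟨hc.1, fun h' => hc.2 (by simp [h, h'])⟩
    · exact Or.inl ⟨hc.1, h⟩
  smul_mem' r p hp m := (hp m).subset fun c hc => ⟨hc.1, fun h => hc.2 (by simp [h])⟩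

theorem exists_bound {N n : ℕ} (t : LocT N n) :
    ∃ m : ℕ, ∀ α : Fin n → VIdx N, m < ∑ j, (α j).deg → dUT α t = 0 := by
  induction t using PiTensorProduct.induction_on with
  | smul_tprod r f =>
    choose k hk using fun j => (f j).2
    refine ⟨∑ j, k j, fun α hα => ?_⟩
    obtain ⟨j, -, hj⟩ := Finset.exists_lt_of_sum_lt hα
    have : dUT α (PiTensorProduct.tprod ℝ f) = 0 := by
      rw [dUT, PiTensorProduct.map_tprod]
      exact MultilinearMap.map_coord_zero _ j (dUPow_eq_zero (hk j) hj)
    simp [this]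
  | add a b ha hb =>
    obtain ⟨k, hk⟩ := ha
    obtain ⟨l, hl⟩ := hb
    refine ⟨max k l, fun α hα => ?_⟩
    rw [map_add, hk α (by omega), hl α (by omega), add_zero]

theorem finite_support {N n : ℕ} (L : (Fin n → MIdx N) → Module.End ℝ (LocT N n))
    (p : Coeff N n) (t : LocT N n) :
    (Function.support fun c : CIdx N n => p.1 c * mulT N n (L c.1 (dUT c.2 t))).Finite := by
  obtain ⟨m, hm⟩ := exists_bound t
  refine (p.2 m).subset fun c hc => ⟨?_, fun h => hc (by simp [h])⟩
  by_contra h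
  exact hc (by simp [hm c.2 (not_le.1 h)])

/-- The operator `∑ p_{I;α} L_I (∂/∂u₁)^{α₁} ⋯ (∂/∂u_n)^{α_n}`, for a family `L` of operators on
`Loc(E)^{⊗n}`; on each argument only finitely many terms are nonzero. -/
def opSum {N n : ℕ} (L : (Fin n → MIdx N) → Module.End ℝ (LocT N n)) :
    Coeff N n →ₗ[ℝ] (LocT N n →ₗ[ℝ] Loc N) :=
  LinearMap.mk₂ ℝ (fun p t => ∑ᶠ c : CIdx N n, p.1 c * mulT N n (L c.1 (dUT c.2 t)))
    (fun p q t => by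
      rw [← finsum_add_distrib (finite_support L p t) (finite_support L q t)]
      exact finsum_congr fun c => by simp [add_mul])
    (fun r p t => by
      rw [smul_finsum' r (finite_support L p t)]
      exact finsum_congr fun c => by simp)
    (fun p s t => by
      rw [← finsum_add_distrib (finite_support L p s) (finite_support L p t)]
      exact finsum_congr fun c => by simp [mul_add])
    (fun r p t => by
      rw [smul_finsum' r (finite_support L p t)]
      exact finsum_congr fun c => by simp)

/-- The operator with coefficients `p` with respect to the `d/dx_j`:
`∑ p_{I;α} ((d/dx)^{I₁} (∂/∂u)^{α₁} f₁) ⋯ ((d/dx)^{I_n} (∂/∂u)^{α_n} f_n)`. -/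
def xForm (N n : ℕ) : Coeff N n →ₗ[ℝ] (LocT N n →ₗ[ℝ] Loc N) := opSum dXT

theorem xForm_tprod {N n : ℕ} (p : Coeff N n) (f : Fin n → Loc N) :
    xForm N n p (PiTensorProduct.tprod ℝ f) =
      ∑ᶠ c : CIdx N n, p.1 c * ∏ j, dXPow (c.1 j) (dUPow (c.2 j) (f j)) := by
  simp [xForm, opSum, dXT, dUT, mulT]

/-- The operator with polarized coefficients `q`, that is, with respect to the `d/dy_j`. -/
def yForm (N n : ℕ) [NeZero n] : Coeff N n →ₗ[ℝ] (LocT N n →ₗ[ℝ] Loc N) := opSum dYT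

/-- `LDO(n)`: the `n`-multilinear local differential operators `Loc(E)^{⊗n} → Loc(E)`. -/
def LDO (N n : ℕ) : Submodule ℝ (LocT N n →ₗ[ℝ] Loc N) := LinearMap.range (xForm N n)

instance instAddCommGroupLDO (N n : ℕ) : AddCommGroup (LDO N n) :=
  @Submodule.addCommGroup ℝ (LocT N n →ₗ[ℝ] Loc N) _ _ _ (LDO N n)

/-- Integration by parts of polarized coefficients: the coefficients
`∑_{I₁} (-1)^{|I₁|} (d/dx)^{I₁} q_{I₁,I₂,…,I_n;α}` at the indices `(0, I₂, …, I_n; α)`, and zero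
at the indices whose first multi-index is not zero. -/
def charCoeff {N n : ℕ} [NeZero n] (q : Coeff N n) : Coeff N n where
  val c := if c.1 0 = 0 then
    ∑ᶠ K : MIdx N, (-1 : ℝ) ^ (∑ i, K i) • dXPow K (q.1 (Function.update c.1 0 K, c.2)) else 0
  property m := by
    refine ((q.2 m).image fun c => (Function.update c.1 0 0, c.2)).subset ?_
    rintro ⟨I, α⟩ ⟨hm, hc⟩
    by_cases h : I 0 = 0
    · simp only [h, if_true] at hc
      obtain ⟨K, hK⟩ := not_forall.1 (mt finsum_eq_zero_of_forall_eq_zero hc)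
      refine ⟨(Function.update I 0 K, α), ⟨hm, fun h' => hK (by simp [h'])⟩, ?_⟩
      simp [← h]
    · simp [h] at hc

open Classical in
/-- The characteristic `χ(A)`, computed from the polarized form of `A`. Since `χ(A)` contains no
`d/dy₁` and `d/dy_j = d/dx_j` for `j ≥ 2`, it may be written with respect to the `d/dx_j`. -/
def chi {N n : ℕ} [NeZero n] (A : LDO N n) : LDO N n :=
  if h : ∃ q : Coeff N n, yForm N n q = A then ⟨xForm N n (charCoeff h.choose), _, rfl⟩ else 0

theorem dX_prod {N : ℕ} {ι : Type} [DecidableEq ι] (i : Fin N) (s : Finset ι) (f : ι → Loc N) :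
    dX i (∏ j ∈ s, f j) = ∑ j ∈ s, dX i (f j) * ∏ k ∈ s.erase j, f k := by
  have h1 : dX i (1 : Loc N) = 0 := by simpa using dX_mul i (1 : Loc N) 1
  induction s using Finset.induction_on with
  | empty => simpa using h1
  | insert a s ha ih =>
    rw [Finset.prod_insert ha, dX_mul, ih, Finset.sum_insert ha, Finset.erase_insert ha,
      Finset.mul_sum]
    congr 1
    refine Finset.sum_congr rfl fun j hj => ?_
    have hja : a ≠ j := fun h => ha (h ▸ hj)
    rw [Finset.erase_insert_of_ne hja, Finset.prod_insert (by simp [ha])]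
    ring

theorem dX_mulT {N n : ℕ} (i : Fin N) (t : LocT N n) :
    dX i (mulT N n t) = ∑ j, mulT N n (dXSlot j i t) := by
  have : dX i ∘ₗ mulT N n = ∑ j, mulT N n ∘ₗ dXSlot j i := by
    ext f : 2
    simp only [mulT, dXSlot, LinearMap.compMultilinearMap_apply, LinearMap.comp_apply,
      LinearMap.sum_apply, PiTensorProduct.map_tprod, PiTensorProduct.lift.tprod,
      MultilinearMap.mkPiAlgebra_apply]
    rw [dX_prod]
    refine Finset.sum_congr rfl fun j _ => ?_
    rw [← Finset.mul_prod_erase _ _ (Finset.mem_univ j), Function.update_self]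
    congr 1
    refine Finset.prod_congr rfl fun k hk => ?_
    rw [Function.update_of_ne (Finset.ne_of_mem_erase hk)]; rfl
  simpa using LinearMap.congr_fun this t

theorem dXSlot_mul_dXT {N n : ℕ} (j : Fin n) (i : Fin N) (I : Fin n → MIdx N) :
    dXSlot j i * dXT I = dXT (Function.update I j (MIdx.up i (I j))) := by
  unfold dXSlot dXT
  rw [← PiTensorProduct.map_mul]
  congr 1
  funext k
  by_cases h : k = j
  · subst h
    simpa using dX_mul_dXPow i (I k)
  · rw [Function.update_of_ne h, Function.update_of_ne h]; rfl

/-- Reindexing of coefficients along an injective map of the multi-indices `I`. -/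
def pushCoeff {N n : ℕ} (ρ : (Fin n → MIdx N) → (Fin n → MIdx N)) (hρ : ρ.Injective)
    (p : Coeff N n) : Coeff N n where
  val := Function.extend (Prod.map ρ id) p.1 0
  property m := by
    refine ((p.2 m).image (Prod.map ρ id)).subset ?_
    rintro c ⟨hm, hc⟩
    have hi : (Prod.map ρ (id : (Fin n → VIdx N) → _)).Injective := hρ.prodMap Function.injective_id
    by_cases h : ∃ a, Prod.map ρ id a = c
    · obtain ⟨a, rfl⟩ := h
      rw [hi.extend_apply] at hc
      exact ⟨a, ⟨hm, hc⟩, rfl⟩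
    · rw [Function.extend_apply' _ _ _ h] at hc
      exact absurd rfl hc

theorem opSum_push {N n : ℕ} (L : (Fin n → MIdx N) → Module.End ℝ (LocT N n))
    (ρ : (Fin n → MIdx N) → (Fin n → MIdx N)) (hρ : ρ.Injective) (p : Coeff N n) :
    opSum (fun I => L (ρ I)) p = opSum L (pushCoeff ρ hρ p) := by
  have hi : (Prod.map ρ (id : (Fin n → VIdx N) → _)).Injective := hρ.prodMap Function.injective_id
  refine LinearMap.ext fun t => ?_
  change ∑ᶠ c : CIdx N n, p.1 c * mulT N n (L (ρ c.1) (dUT c.2 t)) =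
    ∑ᶠ c : CIdx N n, Function.extend (Prod.map ρ id) p.1 0 c * mulT N n (L c.1 (dUT c.2 t))
  rw [← finsum_mem_univ (f := fun c : CIdx N n => Function.extend (Prod.map ρ id) p.1 0 c * _),
    ← finsum_mem_inter_support_eq (s := Set.range (Prod.map ρ id)), finsum_mem_range hi]
  · exact finsum_congr fun c => by rw [hi.extend_apply]; rfl
  · ext c
    simp only [Set.mem_inter_iff, Set.mem_univ, true_and, and_iff_right_iff_imp]
    intro hc
    by_contra h
    have h0 : Function.extend (Prod.map ρ id) p.1 0 c = 0 :=
      Function.extend_apply' p.1 (0 : CIdx N n → Loc N) c h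
    exact hc (by simp [h0])

/-- The coefficients `dp/dxⁱ`. -/
def derivCoeff {N n : ℕ} (i : Fin N) (p : Coeff N n) : Coeff N n :=
  ⟨fun c => dX i (p.1 c), fun m => (p.2 m).subset fun c hc => ⟨hc.1, fun h => hc.2 (by simp [h])⟩⟩

/-- The composition `d/dxⁱ ∘ A` is a local differential operator. -/
theorem dX_comp_mem {N n : ℕ} (i : Fin N) {A : LocT N n →ₗ[ℝ] Loc N} (hA : A ∈ LDO N n) :
    dX i ∘ₗ A ∈ LDO N n := by
  obtain ⟨p, rfl⟩ := hA
  have hρ : ∀ j : Fin n, Function.Injective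
      fun I : Fin n → MIdx N => Function.update I j (MIdx.up i (I j)) := by
    intro j I K h
    funext k
    have hk := congrFun h k
    by_cases hkj : k = j
    · subst hkj
      simpa [MIdx.up] using hk
    · simpa [hkj] using hk
  refine ⟨derivCoeff i p + ∑ j, pushCoeff _ (hρ j) p, ?_⟩
  rw [map_add, map_sum]
  simp only [xForm]
  simp only [← opSum_push]
  refine LinearMap.ext fun t => ?_
  rw [LinearMap.add_apply, LinearMap.sum_apply]
  change ∑ᶠ c : CIdx N n, dX i (p.1 c) * mulT N n (dXT c.1 (dUT c.2 t)) +
    ∑ j, ∑ᶠ c : CIdx N n, p.1 c * mulT N n (dXT (Function.update c.1 j (MIdx.up i (c.1 j)))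
      (dUT c.2 t)) = dX i (∑ᶠ c : CIdx N n, p.1 c * mulT N n (dXT c.1 (dUT c.2 t)))
  have e : dX i (∑ᶠ c : CIdx N n, p.1 c * mulT N n (dXT c.1 (dUT c.2 t))) =
      ∑ᶠ c : CIdx N n, dX i (p.1 c * mulT N n (dXT c.1 (dUT c.2 t))) :=
    (dX i).toAddMonoidHom.map_finsum (finite_support dXT p t)
  have fin : ∀ j, (Function.support fun c : CIdx N n => p.1 c *
      mulT N n (dXT (Function.update c.1 j (MIdx.up i (c.1 j))) (dUT c.2 t))).Finite := fun j =>
    finite_support (fun I => dXT (Function.update I j (MIdx.up i (I j)))) p t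
  rw [e, ← finsum_sum_comm _ _ fun j _ => fin j,
    ← finsum_add_distrib (f := fun c : CIdx N n => dX i (p.1 c) * mulT N n (dXT c.1 (dUT c.2 t)))
      (finite_support dXT (derivCoeff i p) t)]
  · refine finsum_congr fun c => ?_
    rw [dX_mul, dX_mulT, Finset.mul_sum]
    congr 1
    refine Finset.sum_congr rfl fun j _ => ?_
    rw [← dXSlot_mul_dXT]; rfl
  · refine (Set.finite_iUnion fin).subset fun c hc => ?_
    obtain ⟨j, -, hj⟩ := Finset.exists_ne_zero_of_sum_ne_zero hc
    exact Set.mem_iUnion.2 ⟨j, hj⟩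

/-- `A ↦ d/dxⁱ ∘ A` on `LDO(n)`. -/
def postD {N n : ℕ} (i : Fin N) : Module.End ℝ (LDO N n) where
  toFun A := ⟨dX i ∘ₗ A.1, dX_comp_mem i A.2⟩
  map_add' _ _ := Subtype.ext (LinearMap.comp_add _ _ _)
  map_smul' _ _ := Subtype.ext (LinearMap.comp_smul _ _ _)

theorem postD_comm {N n : ℕ} (i j : Fin N) (A : LDO N n) :
    postD i (postD j A) = postD j (postD i A) :=
  Subtype.ext (LinearMap.ext fun t => LinearMap.congr_fun (dX_commute i j).eq (A.1 t))

/-- `O^k(n)`: the forms `∑_ε A_ε (dx)^ε` with `A_ε ∈ LDO(n)`, where the `(dx)^ε` with `|ε| = k` are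
indexed by the `k`-element sets `S = {i ; ε^i = 1}`. -/
abbrev OForm (N n k : ℕ) : Type := {S : Finset (Fin N) // S.card = k} → LDO N n

/-- The sign with `dxⁱ ∧ (dx)^{S \ i} = sign · (dx)^S` for `i ∈ S`. -/
def wedgeSign {N : ℕ} (S : Finset (Fin N)) (i : Fin N) : ℝ :=
  (-1) ^ (S.filter (fun l => l < i)).card

/-- The differential `d(A (dx)^ε) = ∑ᵢ (d/dxⁱ ∘ A) dxⁱ ∧ (dx)^ε`, written in components: the
coefficient of `(dx)^S` in `dθ` is `∑_{i ∈ S} ± d/dxⁱ ∘ θ_{S \ i}`. -/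
def opD (N n k : ℕ) : OForm N n k →ₗ[ℝ] OForm N n (k + 1) where
  toFun θ S := ∑ i ∈ S.1.attach, wedgeSign S.1 i.1 •
    postD i.1 (θ ⟨S.1.erase i.1, by rw [Finset.card_erase_of_mem i.2, S.2, Nat.add_sub_cancel]⟩)
  map_add' θ η := by
    funext S
    simp [Finset.sum_add_distrib]
  map_smul' r θ := by
    funext S
    simp [Finset.smul_sum, smul_comm r]

theorem wedgeSign_swap {N : ℕ} {S : Finset (Fin N)} {i j : Fin N} (hi : i ∈ S) (hj : j ∈ S)
    (hij : i ≠ j) : wedgeSign S i * wedgeSign (S.erase i) j =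
      -(wedgeSign S j * wedgeSign (S.erase j) i) := by
  have key : ∀ i ∈ S, ∀ j ∈ S, i < j → wedgeSign S i * wedgeSign (S.erase i) j =
      -(wedgeSign S j * wedgeSign (S.erase j) i) := by
    intro i hi j hj h
    have h1 : wedgeSign (S.erase j) i = wedgeSign S i := by
      unfold wedgeSign
      rw [Finset.filter_erase, Finset.erase_eq_of_notMem (by simp [h.le])]
    have h2 : wedgeSign S j = -wedgeSign (S.erase i) j := by
      unfold wedgeSign
      have hm : i ∈ S.filter (fun l => l < j) := by simp [hi, h]
      rw [Finset.filter_erase, ← Finset.card_erase_add_one hm, pow_succ]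
      simp
    rw [h1, h2]; ring
  rcases lt_or_gt_of_ne hij with h | h
  · exact key i hi j hj h
  · rw [key j hj i hi h, neg_neg]

theorem opD_comp_opD (N n k : ℕ) : opD N n (k + 1) ∘ₗ opD N n k = 0 := by
  classical
  refine LinearMap.ext fun θ => ?_
  funext S
  let W : Finset (Fin N) → LDO N n := fun T => if h : T.card = k then θ ⟨T, h⟩ else 0
  have hd : ∀ T : {T : Finset (Fin N) // T.card = k + 1}, opD N n k θ T =
      ∑ j ∈ T.1, wedgeSign T.1 j • postD j (W (T.1.erase j)) := by
    intro T
    rw [← Finset.sum_attach]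
    refine Finset.sum_congr rfl fun j _ => ?_
    have : (T.1.erase j.1).card = k := by rw [Finset.card_erase_of_mem j.2, T.2, Nat.add_sub_cancel]
    simp [W, this]
  let F : Fin N → Fin N → LDO N n := fun i j => if i = j then 0 else
    (wedgeSign S.1 i * wedgeSign (S.1.erase i) j) • postD i (postD j (W ((S.1.erase i).erase j)))
  have hF : ∀ i ∈ S.1, ∀ j ∈ S.1, F i j = -F j i := by
    intro i hi j hj
    by_cases h : i = j
    · simp [F, h]
    · simp only [F, h, Ne.symm h, if_false]
      rw [wedgeSign_swap hi hj h, postD_comm, Finset.erase_right_comm, neg_smul]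
  have h1 : opD N n (k + 1) (opD N n k θ) S = ∑ i ∈ S.1, ∑ j ∈ S.1, F i j := by
    rw [← Finset.sum_attach]
    refine Finset.sum_congr rfl fun i _ => ?_
    rw [hd, map_sum, Finset.smul_sum, ← Finset.add_sum_erase _ _ i.2]
    simp only [F, if_true, zero_add]
    refine Finset.sum_congr rfl fun j hj => ?_
    rw [if_neg (Finset.ne_of_mem_erase hj).symm, map_smul, smul_smul]
  have h2 : ∑ i ∈ S.1, ∑ j ∈ S.1, F i j = -∑ i ∈ S.1, ∑ j ∈ S.1, F i j := by
    conv_rhs => rw [Finset.sum_comm]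
    rw [← Finset.sum_neg_distrib]
    refine Finset.sum_congr rfl fun i hi => ?_
    rw [← Finset.sum_neg_distrib]
    exact Finset.sum_congr rfl fun j hj => hF i hi j hj
  rw [LinearMap.comp_apply, h1]
  have h3 : (2 : ℝ) • ∑ i ∈ S.1, ∑ j ∈ S.1, F i j = 0 := by
    rw [two_smul]
    exact eq_neg_iff_add_eq_zero.1 h2
  exact (smul_eq_zero_iff_right (two_ne_zero (α := ℝ))).1 h3

/-- The cocycles of degree `k`. -/
def cocycles (N n k : ℕ) : Submodule ℝ (OForm N n k) := LinearMap.ker (opD N n k)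

/-- The coboundaries of degree `k`. -/
def coboundaries (N n : ℕ) : ∀ k, Submodule ℝ (OForm N n k)
  | 0 => ⊥
  | k + 1 => LinearMap.range (opD N n k)

/-- The cohomology `H^k(O^*(n), d)`. -/
abbrev cohomology (N n k : ℕ) : Type :=
  cocycles N n k ⧸ (coboundaries N n k).submoduleOf (cocycles N n k)

/-- `J(A dx¹ ∧ ⋯ ∧ dx^N) = A`. -/
def topCoeff (N n : ℕ) : OForm N n N →ₗ[ℝ] LDO N n :=
  LinearMap.proj ⟨Finset.univ, Finset.card_fin N⟩

end OpComplex

end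

noncomputable section

namespace OpComplex

/-! For fixed `α` the polarized coefficients form a polynomial over `Loc(E)` in commuting symbols
`y_j^i`, one for each `d/dy_j^i`. Polarization makes composition with `d/dxⁱ` simple: by the Leibniz
rule it becomes `T_i`, multiplication by `y_1^i` plus the derivation `d/dxⁱ` of the coefficients
(`ev_tot`, `yForm_tot`). To pass freely between operators and polynomials one needs the polarized
form to be unique (`yForm_injective`). The formal derivatives of the polynomial are commutators of
the operator with multiplications by coordinates, so a null operator stays null under formal
differentiation; this reduces to an operator without total derivatives, which is tested on monomials
in the `u_J`.

The complex is then a Koszul complex of the commuting `T_i`. The formal derivatives `δ_l = ∂/∂y_1^l`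
satisfy `δ_l T_i = T_i δ_l + [i = l]` (`del_tot`), so contraction `h` with them gives `dh + hd = (N
- k) + ∑ T_i δ_i` on `k`-forms (`koszul_homotopy`). The operator `E_c = c + ∑ T_i δ_i` is triangular
with respect to the degree in `y_1`, with diagonal entries `c + |I₁|`, hence bijective for `c > 0`
(`eulerOp_injective`, `eulerOp_surjective`). As `E_c T_i = T_i E_{c+1}` (`opLift_eulerOp_postD`), a
cocycle `θ` of degree `0 < k < N` equals `d (E_{c+1}⁻¹ h θ)` with `c = N - k`, and a cocycle of
degree `0` vanishes.

In degree `N` the coboundaries are the sums `∑ T_i B_i`. The characteristic substitutes `-d/dx` for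
`y_1`, which kills every `T_i B` (`charPoly_tot`); conversely, repeated integration by parts writes
a polynomial as its characteristic plus such a sum (`exists_sum_tot`). Hence coboundaries and the
kernel of `χ` agree (`ker_charPoly`). -/

/-! ### Coefficient systems as families of polynomials -/

/-- Polynomials with coefficients in `Loc(E)` in the commuting symbols of `n` copies of the total
derivatives. -/
abbrev Poly (N n : ℕ) : Type := (Fin n → MIdx N) →₀ Loc N

/-- The sum of the formal differential degrees of the `αⱼ`. -/
def totalDeg {N n : ℕ} (α : Fin n → VIdx N) : ℕ := ∑ j, (α j).deg

theorem slice_finite {N n : ℕ} (α : Fin n → VIdx N) (p : Coeff N n) :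
    (Function.support fun I => p.1 (I, α)).Finite := by
  refine ((p.2 (totalDeg α)).image Prod.fst).subset fun I hI => ?_
  exact ⟨(I, α), ⟨le_rfl, hI⟩, rfl⟩

/-- The polynomial of the coefficients `p_{I;α}` with fixed `α`. -/
def slice {N n : ℕ} (α : Fin n → VIdx N) : Coeff N n →ₗ[ℝ] Poly N n where
  toFun p := Finsupp.ofSupportFinite _ (slice_finite α p)
  map_add' _ _ := by ext; rfl
  map_smul' _ _ := by ext; rfl

@[simp]
theorem slice_apply {N n : ℕ} (α : Fin n → VIdx N) (p : Coeff N n) (I : Fin n → MIdx N) :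
    slice α p I = p.1 (I, α) := rfl

theorem coeff_ext {N n : ℕ} {p q : Coeff N n} (h : ∀ α, slice α p = slice α q) : p = q :=
  Subtype.ext (funext fun c => DFunLike.congr_fun (h c.2) c.1)

theorem slice_support_finite {N n : ℕ} (p : Coeff N n) (m : ℕ) :
    {α : Fin n → VIdx N | totalDeg α ≤ m ∧ slice α p ≠ 0}.Finite := by
  refine ((p.2 m).image Prod.snd).subset ?_
  rintro α ⟨hm, h⟩
  obtain ⟨I, hI⟩ := DFunLike.ne_iff.1 h
  exact ⟨(I, α), ⟨hm, hI⟩, rfl⟩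

/-- The action of a linear map on polynomials on coefficient systems, for each `α` separately. -/
def liftC {N n : ℕ} : (Poly N n →ₗ[ℝ] Poly N n) →ₗ[ℝ] (Coeff N n →ₗ[ℝ] Coeff N n) where
  toFun θ :=
    { toFun := fun p => ⟨fun c => θ (slice c.2 p) c.1, fun m => by
        refine Set.Finite.subset (s := ⋃ α ∈ {α : Fin n → VIdx N | totalDeg α ≤ m ∧ slice α p ≠ 0},
          (fun I => (I, α)) '' (θ (slice α p)).support)
          ((slice_support_finite p m).biUnion
            fun α _ => (Finset.finite_toSet _).image _) ?_
        rintro ⟨I, α⟩ ⟨hm, hc⟩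
        refine Set.mem_biUnion (x := α) ⟨hm, fun h => hc (by simp [h])⟩ ⟨I, ?_, rfl⟩
        simpa using hc⟩
      map_add' := fun p q => Subtype.ext (funext fun c => by simp)
      map_smul' := fun r p => Subtype.ext (funext fun c => by simp) }
  map_add' _ _ := LinearMap.ext fun _ => rfl
  map_smul' _ _ := LinearMap.ext fun _ => rfl

@[simp]
theorem slice_liftC {N n : ℕ} (θ : Poly N n →ₗ[ℝ] Poly N n) (α : Fin n → VIdx N)
    (p : Coeff N n) : slice α (liftC θ p) = θ (slice α p) := by
  ext I
  rfl

theorem liftC_comp {N n : ℕ} (θ η : Poly N n →ₗ[ℝ] Poly N n) (p : Coeff N n) :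
    liftC (θ ∘ₗ η) p = liftC θ (liftC η p) :=
  coeff_ext fun α => by simp

theorem liftC_id {N n : ℕ} (p : Coeff N n) : liftC LinearMap.id p = p :=
  coeff_ext fun α => by simp

/-- The operator `∑ a_I M_I`, followed by the multiplication, of a polynomial `∑ a_I`. -/
def ev {N n : ℕ} (M : (Fin n → MIdx N) → Module.End ℝ (LocT N n)) :
    Poly N n →ₗ[ℝ] (LocT N n →ₗ[ℝ] Loc N) :=
  Finsupp.lsum ℝ fun I => (LinearMap.lcomp ℝ (Loc N) (mulT N n ∘ₗ M I)) ∘ₗ LinearMap.mul ℝ (Loc N)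

theorem ev_single {N n : ℕ} (M : (Fin n → MIdx N) → Module.End ℝ (LocT N n))
    (I : Fin n → MIdx N) (a : Loc N) (t : LocT N n) :
    ev M (Finsupp.single I a) t = a * mulT N n (M I t) := by
  simp [ev]

theorem ev_apply {N n : ℕ} (M : (Fin n → MIdx N) → Module.End ℝ (LocT N n))
    (P : Poly N n) (t : LocT N n) :
    ev M P t = ∑ᶠ I, P I * mulT N n (M I t) := by
  rw [finsum_eq_sum_of_support_subset (s := P.support)]
  · simp [ev, Finsupp.sum, LinearMap.sum_apply]
  · intro I hI
    simp only [Finset.mem_coe, Finsupp.mem_support_iff]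
    exact fun h => hI (by simp [h])

/-- The index set is a product and only finitely many terms survive on a given argument, so the sum
may be grouped by `α`. This is what lets all later arguments work on one polynomial at a time. -/
theorem opSum_apply {N n : ℕ} (M : (Fin n → MIdx N) → Module.End ℝ (LocT N n))
    (p : Coeff N n) (t : LocT N n) :
    opSum M p t = ∑ᶠ α, ev M (slice α p) (dUT α t) := by
  change ∑ᶠ c : CIdx N n, p.1 c * mulT N n (M c.1 (dUT c.2 t)) = _
  rw [← finsum_comp_equiv (Equiv.prodComm (Fin n → VIdx N) (Fin n → MIdx N)), finsum_curry]
  · exact finsum_congr fun α => by rw [ev_apply]; rfl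
  · have := (finite_support M p t).preimage
      (Equiv.prodComm (Fin n → VIdx N) (Fin n → MIdx N)).injective.injOn
    exact this

theorem opSum_finite {N n : ℕ} (M : (Fin n → MIdx N) → Module.End ℝ (LocT N n))
    (p : Coeff N n) (t : LocT N n) :
    (Function.support fun α => ev M (slice α p) (dUT α t)).Finite := by
  obtain ⟨m, hm⟩ := exists_bound t
  refine (slice_support_finite p m).subset fun α hα => ⟨?_, fun h => hα (by simp [h])⟩
  by_contra h
  exact hα (by simp [hm α (not_le.1 h)])

/-- Used to change the monomial family: an identity between evaluations of polynomials suffices,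
because the vertical derivatives act first and are untouched. -/
theorem opSum_liftC {N n : ℕ} {M M' : (Fin n → MIdx N) → Module.End ℝ (LocT N n)}
    {θ : Poly N n →ₗ[ℝ] Poly N n} (h : ev M' ∘ₗ θ = ev M) (p : Coeff N n) :
    opSum M' (liftC θ p) = opSum M p := by
  refine LinearMap.ext fun t => ?_
  simp only [opSum_apply, slice_liftC, ← h, LinearMap.comp_apply]

/-! ### Monomials in commuting derivatives and the linear change from `x` to `y` -/

/-- The multi-index of the single derivative `d/dxⁱ_j`. -/
def unitIdx {N n : ℕ} (j : Fin n) (i : Fin N) : Fin n → MIdx N := Pi.single j (Pi.single i 1)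

theorem slotIdx_induction {N n : ℕ} {motive : (Fin n → MIdx N) → Prop} (zero : motive 0)
    (add : ∀ I j i, motive I → motive (I + unitIdx j i)) (I : Fin n → MIdx N) : motive I := by
  induction h : ∑ j, ∑ i, I j i generalizing I with
  | zero =>
    have : I = 0 := by
      ext j i
      simp only [Finset.sum_eq_zero_iff, Finset.mem_univ, true_imp_iff] at h
      exact h j i
    rwa [this]
  | succ d ih =>
    obtain ⟨j, i, hji⟩ : ∃ j i, I j i ≠ 0 := by
      by_contra! h0
      simp [h0] at h
    have hI : I - unitIdx j i + unitIdx j i = I := by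
      ext k l
      by_cases hk : k = j
      · subst hk
        by_cases hl : l = i
        · subst hl
          simp [unitIdx]; omega
        · simp [unitIdx, hl]
      · simp [unitIdx, hk]
    rw [← hI] at h ⊢
    refine add _ _ _ (ih _ ?_)
    have hu : ∑ k, ∑ l, unitIdx (n := n) (N := N) j i k l = 1 := by
      rw [Finset.sum_eq_single j, Finset.sum_eq_single i]
      · simp [unitIdx]
      · intro b _ hb; simp [unitIdx, hb]
      · simp
      · intro b _ hb; simp [unitIdx, hb]
      · simp
    simp only [Pi.add_apply, Finset.sum_add_distrib, hu] at h
    omega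

/-- `M_I` is the product of the powers of the commuting operators `L_{j,i}` with exponents `I`. -/
structure IsMonomialFamily {N n : ℕ} (L : Fin n → Fin N → Module.End ℝ (LocT N n))
    (M : (Fin n → MIdx N) → Module.End ℝ (LocT N n)) : Prop where
  zero : M 0 = 1
  add : ∀ I j i, M (I + unitIdx j i) = L j i * M I

theorem dXT_isMonomialFamily (N n : ℕ) :
    IsMonomialFamily (dXSlot (N := N) (n := n)) dXT where
  zero := by
    have h0 : dXPow (0 : MIdx N) = LinearMap.id := by
      rw [dXPow, Finset.noncommProd_eq_pow_card _ _ _ 1 (fun i _ => by simp)]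
      simp [Module.End.one_eq_id]
    simp [dXT, h0, Module.End.one_eq_id]
  add I j i := by
    rw [dXSlot_mul_dXT]
    congr 1
    funext k
    by_cases hk : k = j
    · subst hk; simp [unitIdx, MIdx.up]
    · simp [unitIdx, hk]

theorem dYT_isMonomialFamily (N n : ℕ) [NeZero n] :
    IsMonomialFamily (dYSlot (N := N) (n := n)) dYT where
  zero := by
    rw [dYT, Finset.noncommProd_eq_pow_card _ _ _ 1 (fun i _ => by simp)]
    simp
  add I j i := by
    have h1 : dYT (unitIdx j i) = dYSlot (N := N) (n := n) j i := by
      rw [dYT, ← Finset.mul_noncommProd_erase _ (Finset.mem_univ (j, i)),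
        Finset.noncommProd_eq_pow_card (Finset.univ.erase (j, i)) _
          (fun a _ b _ _ => (dYSlot_commute a.1 b.1 a.2 b.2).pow_pow _ _) 1]
      · simp [unitIdx]
      · rintro ⟨k, l⟩ h
        have h := Finset.ne_of_mem_erase h
        by_cases hk : k = j
        · subst hk
          have : l ≠ i := fun e => h (by rw [e])
          simp [unitIdx, this]
        · simp [unitIdx, hk]
    have h := Finset.noncommProd_mul_distrib (s := (Finset.univ : Finset (Fin n × Fin N)))
      (fun a => dYSlot a.1 a.2 ^ unitIdx j i a.1 a.2) (fun a => dYSlot a.1 a.2 ^ I a.1 a.2)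
      (dYSlot_pow_commute _ _) (dYSlot_pow_commute _ _)
      (fun a _ b _ _ => (dYSlot_commute a.1 b.1 a.2 b.2).pow_pow _ _)
    change _ = dYT (unitIdx j i) * dYT I at h
    rw [← h1, ← h]
    refine Finset.noncommProd_congr rfl (fun a _ => ?_) _
    simp [← pow_add, add_comm]

/-- A product of linear combinations expands into monomials. The operators act on the tensor power,
before the multiplication and the coefficients, so only real scalars occur and no coefficient is
differentiated. -/
theorem mem_span_monomial {N n : ℕ} {L L' : Fin n → Fin N → Module.End ℝ (LocT N n)}
    {M M' : (Fin n → MIdx N) → Module.End ℝ (LocT N n)} (hM : IsMonomialFamily L M)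
    (hM' : IsMonomialFamily L' M')
    (h : ∀ j i, L j i ∈ Submodule.span ℝ (Set.range fun a : Fin n × Fin N => L' a.1 a.2))
    (I : Fin n → MIdx N) : M I ∈ Submodule.span ℝ (Set.range M') := by
  induction I using slotIdx_induction with
  | zero => rw [hM.zero, ← hM'.zero]; exact Submodule.subset_span ⟨0, rfl⟩
  | add I j i ih =>
    rw [hM.add]
    refine Submodule.span_induction (p := fun x _ => x * M I ∈ _) ?_ (by simp) ?_ ?_ (h j i)
    · rintro _ ⟨⟨k, l⟩, rfl⟩
      refine Submodule.span_induction (p := fun x _ => L' k l * x ∈ _) ?_ (by simp) ?_ ?_ ih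
      · rintro _ ⟨K, rfl⟩
        exact Submodule.subset_span ⟨K + unitIdx k l, hM'.add _ _ _⟩
      · intro x y _ _ hx hy
        rw [mul_add]; exact add_mem hx hy
      · intro r x _ hx
        rw [mul_smul_comm]; exact Submodule.smul_mem _ r hx
    · intro x y _ _ hx hy
      rw [add_mul]; exact add_mem hx hy
    · intro r x _ hx
      rw [smul_mul_assoc]; exact Submodule.smul_mem _ r hx

theorem exists_change_of_monomials {N n : ℕ}
    {M M' : (Fin n → MIdx N) → Module.End ℝ (LocT N n)}
    (h : ∀ I, M I ∈ Submodule.span ℝ (Set.range M')) :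
    ∃ θ : Poly N n →ₗ[ℝ] Poly N n, ev M' ∘ₗ θ = ev M := by
  choose a ha using fun I => Finsupp.mem_span_range_iff_exists_finsupp.1 (h I)
  refine ⟨Finsupp.lsum ℝ fun I => ∑ K ∈ (a I).support, a I K • Finsupp.lsingle K, ?_⟩
  refine Finsupp.lhom_ext fun I f => LinearMap.ext fun t => ?_
  simp only [LinearMap.comp_apply, Finsupp.lsum_single, LinearMap.sum_apply, map_sum,
    LinearMap.smul_apply, map_smul, Finsupp.lsingle_apply, ev_single]
  rw [← ha I, Finsupp.sum, LinearMap.sum_apply, map_sum, Finset.mul_sum]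
  exact Finset.sum_congr rfl fun K _ => by simp

theorem range_opSum_le {N n : ℕ} {L L' : Fin n → Fin N → Module.End ℝ (LocT N n)}
    {M M' : (Fin n → MIdx N) → Module.End ℝ (LocT N n)} (hM : IsMonomialFamily L M)
    (hM' : IsMonomialFamily L' M')
    (h : ∀ j i, L j i ∈ Submodule.span ℝ (Set.range fun a : Fin n × Fin N => L' a.1 a.2)) :
    LinearMap.range (opSum M) ≤ LinearMap.range (opSum M') := by
  obtain ⟨θ, hθ⟩ := exists_change_of_monomials (mem_span_monomial hM hM' h)
  rintro _ ⟨p, rfl⟩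
  exact ⟨liftC θ p, opSum_liftC hθ p⟩

/-- The change of derivatives is linear and invertible: `d/dx_1` is `d/dy_1` minus the sum of the
other `d/dy_k`. This is the existence of the polarized form. -/
theorem range_yForm (N n : ℕ) [NeZero n] : LinearMap.range (yForm N n) = LDO N n := by
  have hY : ∀ j i, dYSlot (N := N) (n := n) j i ∈
      Submodule.span ℝ (Set.range fun a : Fin n × Fin N => dYSlot a.1 a.2) :=
    fun j i => Submodule.subset_span ⟨(j, i), rfl⟩
  refine le_antisymm (range_opSum_le (dYT_isMonomialFamily N n) (dXT_isMonomialFamily N n) ?_)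
    (range_opSum_le (dXT_isMonomialFamily N n) (dYT_isMonomialFamily N n) ?_)
  · intro j i
    have hX : ∀ k, dXSlot (N := N) (n := n) k i ∈
        Submodule.span ℝ (Set.range fun a : Fin n × Fin N => dXSlot a.1 a.2) :=
      fun k => Submodule.subset_span ⟨(k, i), rfl⟩
    unfold dYSlot
    split_ifs
    · exact Submodule.sum_mem _ fun k _ => hX k
    · exact hX j
  · intro j i
    by_cases hj : j = 0
    · subst hj
      have e : dXSlot (N := N) (n := n) 0 i =
          dYSlot 0 i + (-1 : ℝ) • ∑ k ∈ Finset.univ.erase (0 : Fin n), dYSlot k i := by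
        have h0 : ∑ k ∈ Finset.univ.erase (0 : Fin n), dYSlot (N := N) (n := n) k i =
            ∑ k ∈ Finset.univ.erase (0 : Fin n), dXSlot k i :=
          Finset.sum_congr rfl fun k hk => by rw [dYSlot, if_neg (Finset.ne_of_mem_erase hk)]
        rw [h0, dYSlot, if_pos rfl, ← Finset.add_sum_erase _ _ (Finset.mem_univ (0 : Fin n))]
        module
      rw [e]
      exact add_mem (hY 0 i) (Submodule.smul_mem _ _ (Submodule.sum_mem _ fun k _ => hY k i))
    · have e : dXSlot (N := N) (n := n) j i = dYSlot j i := by rw [dYSlot, if_neg hj]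
      rw [e]
      exact hY j i

/-! ### Commutators with multiplication by coordinates -/

/-- The local function given by a linear function on a finite jet space. -/
def linLoc {N k : ℕ} (g : FinJet N k →ₗ[ℝ] ℝ) : Loc N :=
  ⟨fun p => g (proj N k p), k, g, (LinearMap.toContinuousLinearMap g).contDiff, fun _ => rfl⟩

/-- The coordinate `xⁱ`. -/
def xCoord {N : ℕ} (i : Fin N) : Loc N :=
  linLoc (k := 0) (LinearMap.proj i ∘ₗ LinearMap.fst ℝ _ _)

/-- The coordinate `u_J`. -/
def uCoord {N : ℕ} (J : MIdx N) : Loc N :=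
  linLoc (k := ∑ i, J i) (LinearMap.proj ⟨J, mem_midx.2 le_rfl⟩ ∘ₗ LinearMap.snd ℝ _ _)

theorem lineDeriv_linLoc {N k : ℕ} (g : FinJet N k →ₗ[ℝ] ℝ) (p v : Jet N) :
    lineDeriv ℝ (linLoc g).1 p v = g (proj N k v) := by
  rw [lineDeriv_local (f := (linLoc g).1) (LinearMap.toContinuousLinearMap g).contDiff (fun _ => rfl),
    ContinuousLinearMap.fderiv]
  rfl

theorem dU_xCoord {N : ℕ} (J : MIdx N) (i : Fin N) : dU J (xCoord i) = 0 := by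
  refine Subtype.ext (funext fun p => ?_)
  exact (lineDeriv_linLoc _ _ _).trans (by simp [proj])

theorem dU_uCoord {N : ℕ} (J K : MIdx N) : dU J (uCoord K) = if J = K then 1 else 0 := by
  refine Subtype.ext (funext fun p => ?_)
  refine (lineDeriv_linLoc _ _ _).trans ?_
  by_cases h : J = K
  · subst h; simp [proj]
  · simp [proj, h, Ne.symm h]

theorem dX_xCoord {N : ℕ} (i l : Fin N) : dX i (xCoord l) = if i = l then 1 else 0 := by
  refine Subtype.ext (funext fun p => ?_)
  change partialX i _ p + ∑ᶠ J : MIdx N, p.2 (MIdx.up i J) * (dU J (xCoord l)).1 p = _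
  simp only [dU_xCoord]
  refine (congrArg (· + _) (lineDeriv_linLoc _ _ _)).trans ?_
  by_cases h : i = l
  · subst h; simp [proj]
  · simp [proj, h, Ne.symm h]

theorem dU_mul {N : ℕ} (J : MIdx N) (a b : Loc N) : dU J (a * b) = dU J a * b + a * dU J b := by
  obtain ⟨a, k, ha⟩ := a
  obtain ⟨b, l, hb⟩ := b
  obtain ⟨g, hg, hag⟩ := ha.mono (le_max_left k l)
  obtain ⟨g', hg', hbg⟩ := hb.mono (le_max_right k l)
  refine Subtype.ext (funext fun p => ?_)
  have h3 := lineDeriv_local (f := a * b) (hg.mul hg') (fun p => by simp [hag, hbg]) p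
    (0, Pi.single J 1)
  rw [fderiv_fun_mul (hg.differentiable (by simp) _) (hg'.differentiable (by simp) _)] at h3
  simp only [add_apply, smul_apply, smul_eq_mul,
    ← lineDeriv_local hg hag, ← lineDeriv_local hg' hbg, ← hag, ← hbg] at h3
  refine h3.trans ?_
  change _ = partialU J a p * b p + a p * partialU J b p
  unfold partialU
  ring

/-- The operator `φ` acting on the `j`-th tensor factor. -/
def slotOp {N n : ℕ} (j : Fin n) (φ : Module.End ℝ (Loc N)) : Module.End ℝ (LocT N n) :=
  PiTensorProduct.map (Function.update (fun _ => LinearMap.id) j φ)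

theorem slotOp_mul {N n : ℕ} (j : Fin n) (φ ψ : Module.End ℝ (Loc N)) :
    slotOp j (φ * ψ) = slotOp j φ * slotOp j ψ := by
  unfold slotOp
  rw [← PiTensorProduct.map_mul]
  congr 1
  funext k
  by_cases h : k = j
  · subst h; simp
  · simp only [Function.update_of_ne h]; rfl

theorem slotOp_commute {N n : ℕ} {j k : Fin n} (h : j ≠ k) (φ ψ : Module.End ℝ (Loc N)) :
    Commute (slotOp j φ) (slotOp k ψ) := by
  unfold slotOp
  rw [commute_iff_eq, ← PiTensorProduct.map_mul, ← PiTensorProduct.map_mul]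
  congr 1
  funext m
  by_cases hj : m = j
  · subst hj
    rw [Function.update_self, Function.update_of_ne h]; rfl
  · by_cases hk : m = k
    · subst hk
      rw [Function.update_self, Function.update_of_ne hj]; rfl
    · rw [Function.update_of_ne hj, Function.update_of_ne hk]

theorem slotOp_add {N n : ℕ} (j : Fin n) (φ ψ : Module.End ℝ (Loc N)) :
    slotOp j (φ + ψ) = slotOp j φ + slotOp j ψ :=
  PiTensorProduct.map_update_add _ _ _ _

theorem slotOp_zero {N n : ℕ} (j : Fin n) : slotOp j (0 : Module.End ℝ (Loc N)) = 0 := by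
  have h : slotOp j ((0 : ℝ) • (0 : Module.End ℝ (Loc N))) = (0 : ℝ) • slotOp j 0 :=
    PiTensorProduct.map_update_smul _ _ _ _
  simpa only [zero_smul] using h

theorem slotOp_one {N n : ℕ} (j : Fin n) : slotOp j (1 : Module.End ℝ (Loc N)) = 1 := by
  unfold slotOp
  have : Function.update (fun _ : Fin n => (LinearMap.id : Loc N →ₗ[ℝ] Loc N)) j 1 =
      fun _ => LinearMap.id := by
    funext k
    by_cases h : k = j
    · subst h; simp [Module.End.one_eq_id]
    · simp [h]
  rw [this, PiTensorProduct.map_id]; rfl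

/-- The multiplication by `xⁱ` on local functions. -/
def xMul {N : ℕ} (i : Fin N) : Module.End ℝ (Loc N) := LinearMap.mulLeft ℝ (xCoord i)

theorem dX_mul_xMul {N : ℕ} (i l : Fin N) :
    dX i * xMul l = xMul l * dX i + if i = l then 1 else 0 := by
  refine LinearMap.ext fun f => ?_
  change dX i (xCoord l * f) = _
  rw [dX_mul, dX_xCoord, add_comm]
  by_cases h : i = l <;> simp [h, xMul]

theorem dU_commute_xMul {N : ℕ} (J : MIdx N) (l : Fin N) : Commute (dU J) (xMul l) := by
  refine LinearMap.ext fun f => ?_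
  change dU J (xCoord l * f) = _
  rw [dU_mul, dU_xCoord]
  simp [xMul]

theorem dUPow_commute_xMul {N : ℕ} (α : VIdx N) (l : Fin N) : Commute (dUPow α) (xMul l) :=
  (Finset.noncommProd_commute _ _ _ _ fun J _ =>
    ((dU_commute_xMul J l).pow_left _).symm).symm

/-- The Weyl relation in each tensor factor; operators in different factors commute. -/
theorem dXSlot_mul_xMul {N n : ℕ} (j k : Fin n) (i l : Fin N) :
    dXSlot j i * slotOp k (xMul l) =
      slotOp k (xMul l) * dXSlot j i + if j = k ∧ i = l then 1 else 0 := by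
  change slotOp j (dX i) * _ = _ * slotOp j (dX i) + _
  by_cases h : j = k
  · subst h
    rw [← slotOp_mul, dX_mul_xMul, slotOp_add, slotOp_mul]
    congr 1
    by_cases hi : i = l
    · simp [hi, slotOp_one]
    · simp only [hi, if_false, and_false, slotOp_zero]
  · simp [h, (slotOp_commute h (dX i) (xMul l)).eq]

theorem dUT_commute_xMul {N n : ℕ} (α : Fin n → VIdx N) (k : Fin n) (l : Fin N) :
    Commute (dUT α) (slotOp k (xMul l)) := by
  unfold slotOp dUT
  rw [commute_iff_eq, ← PiTensorProduct.map_mul, ← PiTensorProduct.map_mul]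
  congr 1
  funext m
  by_cases hj : m = k
  · subst hj
    simp only [Function.update_self, (dUPow_commute_xMul (α m) l).eq]
  · simp only [Function.update_of_ne hj]; rfl

/-- After multiplication it no longer matters which factor carried `xˡ`. Consequently a difference
of two copies of `xˡ` acts as zero there. -/
theorem mulT_slotOp {N n : ℕ} (k : Fin n) (l : Fin N) (t : LocT N n) :
    mulT N n (slotOp k (xMul l) t) = xCoord l * mulT N n t := by
  have : mulT N n ∘ₗ slotOp k (xMul l) = LinearMap.mulLeft ℝ (xCoord l) ∘ₗ mulT N n := by
    ext f : 2
    simp only [mulT, slotOp, LinearMap.compMultilinearMap_apply, LinearMap.comp_apply,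
      PiTensorProduct.map_tprod, PiTensorProduct.lift.tprod,
      MultilinearMap.mkPiAlgebra_apply, LinearMap.mulLeft_apply]
    rw [← Finset.mul_prod_erase _ _ (Finset.mem_univ k), Function.update_self,
      ← Finset.mul_prod_erase _ f (Finset.mem_univ k), ← mul_assoc]
    congr 1
    refine Finset.prod_congr rfl fun m hm => ?_
    rw [Function.update_of_ne (Finset.ne_of_mem_erase hm)]; rfl
  exact LinearMap.congr_fun this t

/-- The multiplications by `xⁱ_j - xⁱ_0` for `j ≠ 0` and by `xⁱ_0`. -/
def dualMul {N n : ℕ} [NeZero n] (j : Fin n) (i : Fin N) : Module.End ℝ (LocT N n) :=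
  if j = 0 then slotOp 0 (xMul i)
  else slotOp j (xMul i) + (-1 : ℝ) • slotOp 0 (xMul i)

/-- The coordinates dual to the `d/dy_j` are `x_1` and the differences `x_j - x_1`: the sum of all
`d/dx_m` annihilates differences, and `d/dx_j` with `j ≥ 2` does not see `x_1`. -/
theorem dYSlot_mul_dualMul {N n : ℕ} [NeZero n] (j k : Fin n) (i l : Fin N) :
    dYSlot j i * dualMul k l = dualMul k l * dYSlot j i + if j = k ∧ i = l then 1 else 0 := by
  have h0 : ∀ k : Fin n, (∑ m, dXSlot m i) * slotOp k (xMul l) =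
      slotOp k (xMul l) * (∑ m, dXSlot m i) + if i = l then 1 else 0 := by
    intro k
    simp_rw [Finset.sum_mul, dXSlot_mul_xMul, Finset.sum_add_distrib, Finset.mul_sum, ite_and,
      Finset.sum_ite_eq' Finset.univ k]
    simp
  unfold dYSlot dualMul
  by_cases hj : j = 0
  · subst hj
    by_cases hk : k = 0
    · subst hk
      simp [h0]
    · simp only [if_true, hk, if_false, mul_add, add_mul, h0, Ne.symm hk, false_and, add_zero,
        mul_smul_comm, smul_mul_assoc]
      module
  · by_cases hk : k = 0
    · subst hk
      simp [hj, dXSlot_mul_xMul]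
    · simp only [hj, hk, if_false, mul_add, add_mul, dXSlot_mul_xMul, false_and, add_zero,
        mul_smul_comm, smul_mul_assoc]
      module

theorem dUT_commute_dualMul {N n : ℕ} [NeZero n] (α : Fin n → VIdx N) (k : Fin n) (l : Fin N) :
    Commute (dUT α) (dualMul k l) := by
  unfold dualMul
  split_ifs
  · exact dUT_commute_xMul ..
  · exact (dUT_commute_xMul ..).add_right ((dUT_commute_xMul ..).smul_right _)

/-- The local function by which `dualMul` acts after the multiplication. -/
def dualScalar {N n : ℕ} [NeZero n] (j : Fin n) (i : Fin N) : Loc N :=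
  if j = 0 then xCoord i else 0

theorem mulT_dualMul {N n : ℕ} [NeZero n] (k : Fin n) (l : Fin N) (t : LocT N n) :
    mulT N n (dualMul k l t) = dualScalar k l * mulT N n t := by
  unfold dualMul dualScalar
  split_ifs
  · exact mulT_slotOp ..
  · simp [mulT_slotOp]

theorem sub_add_unitIdx {N n : ℕ} {I : Fin n → MIdx N} {j : Fin n} {i : Fin N}
    (h : I j i ≠ 0) : I - unitIdx j i + unitIdx j i = I := by
  ext k l
  by_cases hk : k = j
  · subst hk
    by_cases hl : l = i
    · subst hl
      simp [unitIdx]; omega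
    · simp [unitIdx, hl]
  · simp [unitIdx, hk]

theorem unitIdx_apply {N n : ℕ} (j k : Fin n) (i l : Fin N) :
    unitIdx j i k l = if j = k ∧ i = l then 1 else 0 := by
  by_cases hk : j = k
  · subst hk
    by_cases hl : i = l
    · subst hl
      simp [unitIdx]
    · simp [unitIdx, hl, Ne.symm hl]
  · simp [unitIdx, hk, Ne.symm hk]

theorem dYT_mul_dualMul {N n : ℕ} [NeZero n] (I : Fin n → MIdx N) (k : Fin n) (l : Fin N) :
    dYT I * dualMul k l = dualMul k l * dYT I + (I k l : ℝ) • dYT (I - unitIdx k l) := by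
  have hM := dYT_isMonomialFamily N n
  induction I using slotIdx_induction with
  | zero => simp [hM.zero]
  | add I j i ih =>
    rw [hM.add, mul_assoc, ih, mul_add, ← mul_assoc, dYSlot_mul_dualMul, add_mul, mul_assoc,
      add_assoc, mul_smul_comm, ← hM.add]
    congr 1
    rw [Pi.add_apply, Pi.add_apply, unitIdx_apply]
    by_cases h : j = k ∧ i = l
    · obtain ⟨rfl, rfl⟩ := h
      rw [if_pos ⟨rfl, rfl⟩, if_pos ⟨rfl, rfl⟩, add_tsub_cancel_right, one_mul]
      -- Subtraction of multi-indices is truncated, so `I - unitIdx` can be undone only if the entry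
      -- is nonzero; if it is zero, the factor in front vanishes.
      by_cases hI : I j i = 0
      · simp [hI]
      · rw [← hM.add, sub_add_unitIdx hI, Nat.cast_add, add_smul, add_comm]
        simp
    · rw [if_neg h, if_neg h, zero_mul, zero_add, add_zero]
      by_cases hI : I k l = 0
      · simp [hI]
      · congr 1
        rw [← hM.add]
        congr 1
        conv_rhs => rw [← sub_add_unitIdx hI, add_right_comm, add_tsub_cancel_right]

/-- The formal derivative of a polynomial with respect to the symbol with index `(k, l)`. -/
def del {N n : ℕ} (k : Fin n) (l : Fin N) : Poly N n →ₗ[ℝ] Poly N n :=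
  Finsupp.lsum ℝ fun I => (I k l : ℝ) • Finsupp.lsingle (I - unitIdx k l)

theorem del_single {N n : ℕ} (k : Fin n) (l : Fin N) (I : Fin n → MIdx N) (a : Loc N) :
    del k l (Finsupp.single I a) = (I k l : ℝ) • Finsupp.single (I - unitIdx k l) a := by
  simp [del]

theorem del_apply {N n : ℕ} (k : Fin n) (l : Fin N) (P : Poly N n) (I : Fin n → MIdx N) :
    del k l P I = ((I k l : ℝ) + 1) • P (I + unitIdx k l) := by
  induction P using Finsupp.induction_linear with
  | zero => simp
  | add P Q hP hQ => simp [hP, hQ]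
  | single J a =>
    rw [del_single]
    by_cases hJ : J k l = 0
    · have : I + unitIdx k l ≠ J := fun h => by
        subst h; simp [unitIdx_apply] at hJ
      simp [hJ, Finsupp.single_eq_of_ne this]
    · obtain ⟨K, rfl⟩ : ∃ K, J = K + unitIdx k l := ⟨_, (sub_add_unitIdx hJ).symm⟩
      rw [add_tsub_cancel_right]
      by_cases h : I = K
      · subst h
        simp [unitIdx_apply]
      · simp [Finsupp.single_eq_of_ne h, h]

/-- The commutator of a monomial with a dual coordinate is its formal derivative, so the derivative
of the polynomial is expressed by the operator alone. -/
theorem ev_del {N n : ℕ} [NeZero n] (k : Fin n) (l : Fin N) (P : Poly N n) (t : LocT N n) :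
    ev dYT (del k l P) t = ev dYT P (dualMul k l t) - dualScalar k l * ev dYT P t := by
  induction P using Finsupp.induction_linear with
  | zero => simp
  | add P Q hP hQ =>
    simp only [map_add, LinearMap.add_apply, hP, hQ]
    ring
  | single I a =>
    have h := LinearMap.congr_fun (dYT_mul_dualMul I k l) t
    simp only [Module.End.mul_apply, LinearMap.add_apply, LinearMap.smul_apply] at h
    rw [del_single, map_smul, LinearMap.smul_apply, ev_single, ev_single, ev_single, h, map_add,
      mulT_dualMul, map_smul, mul_add, mul_smul_comm]
    ring

/-- The right-hand side depends only on the operator, hence null operators are stable under formal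
differentiation of their coefficients. The exponents `α` are unaffected because `∂/∂u_J` commutes
with multiplication by `xˡ`. -/
theorem yForm_del {N n : ℕ} [NeZero n] (k : Fin n) (l : Fin N) (p : Coeff N n)
    (t : LocT N n) : yForm N n (liftC (del k l) p) t =
      yForm N n p (dualMul k l t) - dualScalar k l * yForm N n p t := by
  have hc : ∀ α, dUT α (dualMul k l t) = dualMul k l (dUT α t) := fun α =>
    LinearMap.congr_fun (dUT_commute_dualMul α k l).eq t
  simp only [yForm, opSum_apply, slice_liftC, ev_del]
  have e : dualScalar k l * ∑ᶠ α, ev dYT (slice α p) (dUT α t) =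
      ∑ᶠ α, dualScalar k l * ev dYT (slice α p) (dUT α t) :=
    (LinearMap.mulLeft ℝ (dualScalar k l)).toAddMonoidHom.map_finsum (opSum_finite dYT p t)
  rw [e, ← finsum_sub_distrib]
  · simp only [hc]
  · exact opSum_finite dYT p (dualMul k l t)
  · exact (opSum_finite dYT p t).subset fun α hα h => hα (by simp [h])

/-! ### Testing vertical derivatives on monomials, and uniqueness of the polarized form -/

theorem vIdx_induction {N : ℕ} {motive : VIdx N → Prop} (zero : motive 0)
    (add : ∀ α J, motive α → motive (α + Finsupp.single J 1)) (α : VIdx N) : motive α := by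
  have key : ∀ β α : VIdx N, motive α → motive (α + β) := by
    intro β
    induction β using Finsupp.induction_linear with
    | zero => simp
    | add β γ hβ hγ =>
      intro α hα
      rw [← add_assoc]
      exact hγ _ (hβ α hα)
    | single J b =>
      intro α hα
      induction b with
      | zero => simpa using hα
      | succ b ih =>
        rw [Finsupp.single_add, ← add_assoc]
        exact add _ _ ih
  simpa using key α 0 zero

theorem dUPow_zero {N : ℕ} : dUPow (0 : VIdx N) = 1 := rfl

theorem dUPow_add_single {N : ℕ} (α : VIdx N) (J : MIdx N) :
    dUPow (α + Finsupp.single J 1) = dUPow α * dU J := by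
  have hs : (α + Finsupp.single J 1).support = insert J α.support := by
    ext K
    by_cases h : K = J
    · subst h; simp
    · simp [h]
  have key : ∀ s : Finset (MIdx N), J ∉ s →
      ∀ h1 h2, s.noncommProd (fun K => dU K ^ (α + Finsupp.single J 1 : VIdx N) K) h1 =
        s.noncommProd (fun K => dU K ^ α K) h2 := by
    intro s hJ h1 h2
    refine Finset.noncommProd_congr rfl (fun K hK => ?_) _
    have : J ≠ K := fun h => hJ (h ▸ hK)
    simp [Finsupp.single_eq_of_ne this.symm]
  have e : dUPow (α + Finsupp.single J 1) =
      (insert J α.support).noncommProd (fun K => dU K ^ (α + Finsupp.single J 1 : VIdx N) K)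
        (dU_pow_commute _ _) := Finset.noncommProd_congr hs (fun _ _ => rfl) _
  rw [e, ← Finset.noncommProd_erase_mul _ (Finset.mem_insert_self J _)]
  simp only [Finset.erase_insert_eq_erase]
  rw [key _ (Finset.notMem_erase J _) _ (dU_pow_commute α _)]
  by_cases h : J ∈ α.support
  · rw [dUPow, ← Finset.noncommProd_erase_mul _ h, mul_assoc]
    simp [pow_succ]
  · have h0 : α J = 0 := by simpa using h
    rw [dUPow, Finset.noncommProd_congr (Finset.erase_eq_of_notMem h) fun _ _ => rfl]
    simp [h0]

/-- The monomial `∏_J u_J^{β(J)}`. -/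
def uMonomial {N : ℕ} (β : VIdx N) : Loc N := β.prod fun J k => uCoord J ^ k

theorem uMonomial_add {N : ℕ} (β γ : VIdx N) :
    uMonomial (β + γ) = uMonomial β * uMonomial γ :=
  Finsupp.prod_add_index' (by simp) (fun _ _ _ => pow_add _ _ _)

theorem uMonomial_single {N : ℕ} (J : MIdx N) : uMonomial (Finsupp.single J 1) = uCoord J := by
  simp [uMonomial]

theorem dU_uMonomial {N : ℕ} (J : MIdx N) (β : VIdx N) :
    dU J (uMonomial β) = (β J : ℝ) • uMonomial (β - Finsupp.single J 1) := by
  have h1 : dU J (1 : Loc N) = 0 := by simpa using dU_mul J (1 : Loc N) 1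
  induction β using vIdx_induction with
  | zero => simp [uMonomial, h1]
  | add β K ih =>
    rw [uMonomial_add, uMonomial_single, dU_mul, dU_uCoord, ih]
    by_cases h : J = K
    · subst h
      rw [if_pos rfl, add_tsub_cancel_right, mul_one]
      by_cases h0 : β J = 0
      · simp [h0]
      · have e : β - Finsupp.single J 1 + Finsupp.single J 1 = β :=
          tsub_add_cancel_of_le (by simpa using Nat.one_le_iff_ne_zero.2 h0)
        rw [smul_mul_assoc, ← uMonomial_single, ← uMonomial_add, e]
        simp [add_smul]
    · rw [if_neg h, mul_zero, add_zero, smul_mul_assoc, ← uMonomial_single, ← uMonomial_add]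
      by_cases h0 : β J = 0
      · simp [h0, h]
      · have hle : Finsupp.single J 1 ≤ β := by simpa using Nat.one_le_iff_ne_zero.2 h0
        rw [tsub_add_eq_add_tsub hle]
        simp [Finsupp.single_eq_of_ne h]

/-- The constant is a product of falling factorials; later only its vanishing or nonvanishing
matters. -/
theorem exists_dUPow_uMonomial {N : ℕ} (α β : VIdx N) :
    ∃ c : ℝ, dUPow α (uMonomial β) = c • uMonomial (β - α) ∧ (c ≠ 0 ↔ α ≤ β) := by
  induction α using vIdx_induction generalizing β with
  | zero => exact ⟨1, by simp [dUPow_zero]⟩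
  | add α J ih =>
    obtain ⟨c, hc, hc'⟩ := ih (β - Finsupp.single J 1)
    refine ⟨β J * c, ?_, ?_⟩
    · rw [dUPow_add_single, Module.End.mul_apply, dU_uMonomial, map_smul, hc, smul_smul,
        tsub_tsub, add_comm α]
    · rw [mul_ne_zero_iff, hc', Nat.cast_ne_zero]
      constructor
      · rintro ⟨h0, h⟩
        have hle : Finsupp.single J 1 ≤ β := by simpa using Nat.one_le_iff_ne_zero.2 h0
        exact (add_le_add_left h _).trans (tsub_add_cancel_of_le hle).le
      · intro h
        refine ⟨?_, le_tsub_of_add_le_right h⟩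
        have := h J
        simp at this
        omega

theorem degree_lt {N : ℕ} {α β : VIdx N} (h : α < β) : α.degree < β.degree := by
  have h0 : (β - α).degree ≠ 0 := by
    rw [Ne, Finsupp.degree_eq_zero_iff, tsub_eq_zero_iff_le]
    exact h.not_ge
  have h1 := map_add (Finsupp.degree (σ := MIdx N) (R := ℕ)) (β - α) α
  rw [tsub_add_cancel_of_le h.le] at h1
  omega

theorem deg_mono {N : ℕ} {α β : VIdx N} (h : α ≤ β) : α.deg ≤ β.deg :=
  Finset.sup_mono (Finsupp.support_mono h)

/-- If the low coefficients of a vanishing operator involve no total derivatives, they vanish. -/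
theorem coeff_eq_zero_of_vertical {N n : ℕ} {M : (Fin n → MIdx N) → Module.End ℝ (LocT N n)}
    (hM : M 0 = 1) {p : Coeff N n} (hp : opSum M p = 0) {m : ℕ}
    (h : ∀ I α, totalDeg α ≤ m → I ≠ 0 → p.1 (I, α) = 0) (α : Fin n → VIdx N)
    (hα : totalDeg α ≤ m) : p.1 (0, α) = 0 := by
  -- Induction on the number of vertical derivatives. On the test tensor of the monomials `u^{α_j}`,
  -- the terms with `β ≰ α` vanish, those with `β < α` have zero coefficients by induction, and only
  -- the term of `α` remains.
  induction hs : ∑ j, (α j).degree using Nat.strong_induction_on generalizing α with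
  | _ s ih =>
    subst hs
    choose c hc hc' using fun (β : Fin n → VIdx N) j => exists_dUPow_uMonomial (β j) (α j)
    let t : LocT N n := PiTensorProduct.tprod ℝ fun j => uMonomial (α j)
    have ht : ∀ β, dUT β t =
        (∏ j, c β j) • PiTensorProduct.tprod ℝ fun j => uMonomial (α j - β j) := by
      intro β
      rw [dUT, PiTensorProduct.map_tprod]
      simp only [hc]
      exact MultilinearMap.map_smul_univ _ _ _
    have h1 := LinearMap.congr_fun hp t
    rw [opSum_apply, finsum_eq_single _ α] at h1
    · have e : slice α p = Finsupp.single 0 (p.1 (0, α)) := by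
        ext1 I
        by_cases hI : I = 0
        · subst hI; simp
        · rw [Finsupp.single_eq_of_ne hI]; exact h I α hα hI
      rw [e, ev_single, hM, ht] at h1
      have hne : ∏ j, c α j ≠ 0 := Finset.prod_ne_zero_iff.2 fun j _ => (hc' α j).2 le_rfl
      simpa [mulT, uMonomial, hne] using h1
    · intro β hβ
      by_cases hle : β ≤ α
      · have hdeg : totalDeg β ≤ m :=
          (Finset.sum_le_sum fun j _ => deg_mono (hle j)).trans hα
        have e : slice β p = 0 := by
          ext1 I
          by_cases hI : I = 0
          · subst hI
            refine ih _ ?_ β hdeg rfl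
            obtain ⟨j, hj⟩ := Function.ne_iff.1 hβ
            exact Finset.sum_lt_sum (fun k _ => Finsupp.degree_mono (hle k))
              ⟨j, Finset.mem_univ _, degree_lt ((hle j).lt_of_ne hj)⟩
          · exact h I β hdeg hI
        simp [e]
      · have : ∃ j, ¬ β j ≤ α j := by
          by_contra! h0
          exact hle h0
        obtain ⟨j, hj⟩ := this
        have hz : ∏ j, c β j = 0 :=
          Finset.prod_eq_zero (Finset.mem_univ j) (not_not.1 fun h0 => hj ((hc' β j).1 h0))
        simp [ht, hz]

/-- Formal differentiation lowers the bound `d` on the order and keeps the operator null. By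
induction all formal derivatives vanish in the range of `m`, so in characteristic zero only the
coefficients with `I = 0` are left, and these are handled by `coeff_eq_zero_of_vertical`. The bound
`m` is fixed because the order of `I` is bounded only for bounded degree of `α`. -/
theorem coeff_eq_zero_of_yForm {N n : ℕ} [NeZero n] (m d : ℕ) {p : Coeff N n}
    (hp : yForm N n p = 0)
    (h : ∀ I α, totalDeg α ≤ m → d < ∑ j, ∑ i, I j i → p.1 (I, α) = 0)
    (I : Fin n → MIdx N) (α : Fin n → VIdx N) (hα : totalDeg α ≤ m) : p.1 (I, α) = 0 := by
  have key : ∀ p : Coeff N n, yForm N n p = 0 →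
      (∀ I α, totalDeg α ≤ m → I ≠ 0 → p.1 (I, α) = 0) →
      ∀ I α, totalDeg α ≤ m → p.1 (I, α) = 0 := by
    intro p hp h I α hα
    by_cases hI : I = 0
    · subst hI
      exact coeff_eq_zero_of_vertical (dYT_isMonomialFamily N n).zero hp h α hα
    · exact h I α hα hI
  have hne : ∀ I : Fin n → MIdx N, I ≠ 0 → ∃ j i, I j i ≠ 0 := by
    intro I hI
    obtain ⟨j, hj⟩ := Function.ne_iff.1 hI
    obtain ⟨i, hi⟩ := Function.ne_iff.1 hj
    exact ⟨j, i, hi⟩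
  induction d generalizing p I α with
  | zero =>
    refine key p hp (fun I α hα hI => h I α hα ?_) I α hα
    obtain ⟨j, i, hji⟩ := hne I hI
    exact (Nat.pos_of_ne_zero hji).trans_le ((Finset.single_le_sum (f := fun i => I j i)
      (fun _ _ => Nat.zero_le _) (Finset.mem_univ i)).trans (Finset.single_le_sum
      (f := fun j => ∑ i, I j i) (fun _ _ => Nat.zero_le _) (Finset.mem_univ j)))
  | succ d ih =>
    refine key p hp (fun I α hα hI => ?_) I α hα
    obtain ⟨j, i, hji⟩ := hne I hI
    obtain ⟨K, rfl⟩ : ∃ K, I = K + unitIdx j i := ⟨_, (sub_add_unitIdx hji).symm⟩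
    have hsum : ∀ K : Fin n → MIdx N,
        ∑ k, ∑ l, (K + unitIdx j i) k l = ∑ k, ∑ l, K k l + 1 := by
      intro K
      simp only [Pi.add_apply, Finset.sum_add_distrib, unitIdx_apply, ite_and]
      simp
    have hdel : ∀ I α, (liftC (del j i) p).1 (I, α) =
        ((I j i : ℝ) + 1) • p.1 (I + unitIdx j i, α) := fun I α => del_apply j i (slice α p) I
    have h2 := ih (p := liftC (del j i) p) (LinearMap.ext fun t => by simp [yForm_del, hp])
      (fun I α hα hI => by rw [hdel, h _ α hα (by rw [hsum]; omega), smul_zero]) K α hα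
    rw [hdel] at h2
    exact (smul_eq_zero_iff_right (by positivity)).1 h2

theorem yForm_injective (N n : ℕ) [NeZero n] : Function.Injective (yForm N n) := by
  have key : ∀ p : Coeff N n, yForm N n p = 0 → p = 0 := by
    intro p hp
    refine Subtype.ext (funext fun c => ?_)
    -- Condition `(*)` provides the bound `d` for the degree of the coefficient under consideration.
    have hfin := (p.2 (totalDeg c.2)).image fun c => ∑ j, ∑ i, c.1 j i
    obtain ⟨d, hd⟩ := hfin.bddAbove
    refine coeff_eq_zero_of_yForm (totalDeg c.2) d hp (fun I α hα hI => ?_) c.1 c.2 le_rfl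
    by_contra h0
    exact absurd (hd ⟨(I, α), ⟨hα, h0⟩, rfl⟩) (not_le.2 hI)
  exact (injective_iff_map_eq_zero _).2 key

/-! ### Total derivatives in polarized form and the Euler operator -/

/-- The composition with `d/dxⁱ` on polynomials in the `d/dy_j`. -/
def tot {N n : ℕ} [NeZero n] (i : Fin N) : Poly N n →ₗ[ℝ] Poly N n :=
  Finsupp.lsum ℝ fun I => Finsupp.lsingle (I + unitIdx 0 i) + Finsupp.lsingle I ∘ₗ dX i

theorem tot_single {N n : ℕ} [NeZero n] (i : Fin N) (I : Fin n → MIdx N) (a : Loc N) :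
    tot i (Finsupp.single I a) =
      Finsupp.single (I + unitIdx 0 i) a + Finsupp.single I (dX i a) := by
  simp [tot]

/-- By the Leibniz rule `d/dxⁱ` hits either the coefficient or one of the `n` factors, and the
latter terms add up to the single operator `d/dyⁱ_1`. -/
theorem ev_tot {N n : ℕ} [NeZero n] (i : Fin N) (P : Poly N n) (t : LocT N n) :
    ev dYT (tot i P) t = dX i (ev dYT P t) := by
  induction P using Finsupp.induction_linear with
  | zero => simp
  | add P Q hP hQ => simp only [map_add, LinearMap.add_apply, hP, hQ]
  | single I a =>
    rw [tot_single, map_add, LinearMap.add_apply, ev_single, ev_single, ev_single, dX_mul,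
      dX_mulT, (dYT_isMonomialFamily N n).add, add_comm, dYSlot, if_pos rfl,
      Module.End.mul_apply, LinearMap.sum_apply, map_sum]

theorem yForm_tot {N n : ℕ} [NeZero n] (i : Fin N) (p : Coeff N n) :
    yForm N n (liftC (tot i) p) = dX i ∘ₗ yForm N n p := by
  refine LinearMap.ext fun t => ?_
  simp only [LinearMap.comp_apply, yForm, opSum_apply, slice_liftC, ev_tot]
  exact ((dX i).toAddMonoidHom.map_finsum (opSum_finite dYT p t)).symm

/-- The formal derivative commutes with the derivation of the coefficients, so the commutator comes
only from multiplication by the symbol of `d/dyⁱ_1`. This is the relation behind the homotopy. -/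
theorem del_tot {N n : ℕ} [NeZero n] (i l : Fin N) (P : Poly N n) :
    del 0 l (tot i P) = tot i (del 0 l P) + if i = l then P else 0 := by
  induction P using Finsupp.induction_linear with
  | zero => simp
  | add P Q hP hQ =>
    simp only [map_add, hP, hQ]
    split_ifs
    · exact add_add_add_comm _ _ _ _
    · simp only [add_zero]
  | single I a =>
    rw [tot_single, map_add, del_single, del_single, del_single, map_smul, tot_single, smul_add,
      Pi.add_apply, Pi.add_apply, unitIdx_apply]
    by_cases h : i = l
    · subst h
      rw [if_pos ⟨rfl, rfl⟩, if_pos rfl, add_tsub_cancel_right]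
      by_cases hI : I 0 i = 0
      · simp [hI]
      · rw [sub_add_unitIdx hI]
        push_cast
        module
    · rw [if_neg (by simp [h]), if_neg h, add_zero, add_zero]
      by_cases hI : I 0 l = 0
      · simp [hI]
      · have e : I + unitIdx 0 i - unitIdx 0 l = I - unitIdx 0 l + unitIdx 0 i := by
          conv_lhs => rw [← sub_add_unitIdx hI, add_right_comm, add_tsub_cancel_right]
        rw [e]

/-- The operator `c + ∑ᵢ (d/dxⁱ ∘ ·) ∂/∂(d/dyⁱ_1)`, by which the contracting homotopy acts. -/
def eulerOp {N n : ℕ} [NeZero n] (c : ℝ) : Poly N n →ₗ[ℝ] Poly N n :=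
  c • LinearMap.id + ∑ i, tot i ∘ₗ del 0 i

/-- Symbol times formal derivative counts the exponent, which gives the diagonal entry; the
derivation of the coefficient gives terms of degree one less in `d/dy_1`. Hence the operator is
triangular. -/
theorem eulerOp_single {N n : ℕ} [NeZero n] (c : ℝ) (I : Fin n → MIdx N) (a : Loc N) :
    eulerOp c (Finsupp.single I a) = (c + ∑ i, (I 0 i : ℝ)) • Finsupp.single I a +
      ∑ i, (I 0 i : ℝ) • Finsupp.single (I - unitIdx 0 i) (dX i a) := by
  simp only [eulerOp, LinearMap.add_apply, LinearMap.smul_apply, LinearMap.id_apply,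
    LinearMap.sum_apply, LinearMap.comp_apply, del_single, map_smul, tot_single, smul_add,
    Finset.sum_add_distrib, add_smul, Finset.sum_smul, add_assoc]
  congr 2
  refine Finset.sum_congr rfl fun i _ => ?_
  by_cases hI : I 0 i = 0
  · simp [hI]
  · rw [sub_add_unitIdx hI]

theorem eulerOp_apply {N n : ℕ} [NeZero n] (c : ℝ) (P : Poly N n) (I : Fin n → MIdx N) :
    eulerOp c P I = (c + ∑ i, (I 0 i : ℝ)) • P I +
      ∑ i, ((I 0 i : ℝ) + 1) • dX i (P (I + unitIdx 0 i)) := by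
  induction P using Finsupp.induction_linear with
  | zero => simp
  | add P Q hP hQ =>
    simp only [map_add, Finsupp.add_apply, hP, hQ, smul_add, Finset.sum_add_distrib]
    abel
  | single J a =>
    rw [eulerOp_single, Finsupp.add_apply, Finsupp.smul_apply, Finsupp.finsetSum_apply]
    congr 1
    · by_cases h : I = J
      · subst h; rfl
      · simp [Finsupp.single_eq_of_ne h]
    · refine Finset.sum_congr rfl fun i _ => ?_
      rw [← del_single, del_apply, Finsupp.single_apply, Finsupp.single_apply]
      split_ifs <;> simp

/-- At a monomial of maximal order in `d/dy_1` nothing arrives from higher order, so the coefficient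
is only multiplied by a positive number. -/
theorem eulerOp_injective {N n : ℕ} [NeZero n] {c : ℝ} (hc : 0 < c) :
    Function.Injective (eulerOp (N := N) (n := n) c) := by
  refine (injective_iff_map_eq_zero _).2 fun P hP => ?_
  by_contra hne
  obtain ⟨I, hI, hmax⟩ := P.support.exists_max_image (fun I => ∑ i, I 0 i)
    (Finsupp.support_nonempty_iff.2 hne)
  have h := DFunLike.congr_fun hP I
  have hsum : ∑ i, ((I 0 i : ℝ) + 1) • dX i (P (I + unitIdx 0 i)) = 0 := by
    refine Finset.sum_eq_zero fun i _ => ?_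
    have h0 : P (I + unitIdx 0 i) = 0 := by
      by_contra h0
      have := hmax _ (Finsupp.mem_support_iff.2 h0)
      simp [unitIdx_apply, Finset.sum_add_distrib] at this
    rw [h0, map_zero, smul_zero]
  rw [eulerOp_apply, hsum, add_zero] at h
  have hpos : c + ∑ i, (I 0 i : ℝ) ≠ 0 := by positivity
  exact Finsupp.mem_support_iff.1 hI ((smul_eq_zero_iff_right hpos).1 h)

/-- Back substitution: after division by the diagonal entry, the error has lower order in `d/dy_1`.
-/
theorem eulerOp_surjective {N n : ℕ} [NeZero n] {c : ℝ} (hc : 0 < c) :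
    Function.Surjective (eulerOp (N := N) (n := n) c) := by
  have key : ∀ (d : ℕ) (I : Fin n → MIdx N) (a : Loc N), ∑ i, I 0 i = d →
      Finsupp.single I a ∈ LinearMap.range (eulerOp (N := N) (n := n) c) := by
    intro d
    induction d with
    | zero =>
      intro I a hd
      have h0 : ∀ i, I 0 i = 0 := by simpa [Finset.sum_eq_zero_iff] using hd
      refine ⟨c⁻¹ • Finsupp.single I a, ?_⟩
      rw [map_smul, eulerOp_single]
      simp only [h0, Nat.cast_zero, Finset.sum_const_zero, add_zero, zero_smul]
      rw [smul_smul, inv_mul_cancel₀ hc.ne', one_smul]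
    | succ d ih =>
      intro I a hd
      have hpos : c + ∑ i, (I 0 i : ℝ) ≠ 0 := by positivity
      have h1 := eulerOp_single c I a
      have h2 : Finsupp.single I a = (c + ∑ i, (I 0 i : ℝ))⁻¹ • (eulerOp c (Finsupp.single I a) +
          (-1 : ℝ) • ∑ i, (I 0 i : ℝ) • Finsupp.single (I - unitIdx 0 i) (dX i a)) := by
        rw [h1, add_assoc, ← one_smul ℝ (∑ i, (I 0 i : ℝ) • Finsupp.single _ _), smul_smul,
          ← add_smul]
        simp [smul_smul, inv_mul_cancel₀ hpos]
      rw [h2]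
      refine Submodule.smul_mem _ _ (add_mem ⟨_, rfl⟩ (Submodule.smul_mem _ _
        (Submodule.sum_mem _ fun i _ => ?_)))
      by_cases hI : I 0 i = 0
      · simp [hI]
      · refine Submodule.smul_mem _ _ (ih _ _ ?_)
        rw [← sub_add_unitIdx hI] at hd
        simp only [Pi.add_apply, Finset.sum_add_distrib, unitIdx_apply] at hd
        simpa using hd
  intro P
  induction P using Finsupp.induction_linear with
  | zero => exact ⟨0, map_zero _⟩
  | add P Q hP hQ =>
    obtain ⟨P', rfl⟩ := hP
    obtain ⟨Q', rfl⟩ := hQ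
    exact ⟨P' + Q', map_add _ _ _⟩
  | single I a => exact key _ I a rfl

/-! ### The characteristic as integration by parts -/

theorem dXPow_zero {N : ℕ} : dXPow (0 : MIdx N) = 1 := by
  rw [dXPow, Finset.noncommProd_eq_pow_card _ _ _ 1 (fun i _ => by simp)]
  simp

theorem dX_commute_dXPow {N : ℕ} (i : Fin N) (I : MIdx N) : Commute (dX i) (dXPow I) :=
  Finset.noncommProd_commute _ _ _ _ fun l _ => (dX_commute i l).pow_right _

/-- Integration by parts on polynomials in the `d/dy_j`: the substitution of `-d/dx` for
`d/dy_1`. -/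
def charPoly {N n : ℕ} [NeZero n] : Poly N n →ₗ[ℝ] Poly N n :=
  Finsupp.lsum ℝ fun I =>
    (-1 : ℝ) ^ (∑ i, I 0 i) • (Finsupp.lsingle (Function.update I 0 0) ∘ₗ dXPow (I 0))

theorem charPoly_single {N n : ℕ} [NeZero n] (I : Fin n → MIdx N) (a : Loc N) :
    charPoly (Finsupp.single I a) = (-1 : ℝ) ^ (∑ i, I 0 i) •
      Finsupp.single (Function.update I 0 0) (dXPow (I 0) a) := by
  simp [charPoly]

/-- Substituting `-d/dxⁱ` for the symbol of `d/dyⁱ_1` makes the two terms of `tot` opposite to each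
other. -/
theorem charPoly_tot {N n : ℕ} [NeZero n] (i : Fin N) (P : Poly N n) :
    charPoly (tot i P) = 0 := by
  induction P using Finsupp.induction_linear with
  | zero => simp
  | add P Q hP hQ => rw [map_add, map_add, hP, hQ, add_zero]
  | single I a =>
    have h0 : (I + unitIdx 0 i : Fin n → MIdx N) 0 = MIdx.up i (I 0) := by
      simp [unitIdx, MIdx.up]
    have h1 : Function.update (I + unitIdx 0 i) 0 0 = Function.update I 0 0 := by
      funext j
      by_cases hj : j = 0
      · subst hj; simp
      · simp [hj, unitIdx]
    have h2 : dXPow (MIdx.up i (I 0)) a = dXPow (I 0) (dX i a) := by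
      rw [← dX_mul_dXPow, (dX_commute_dXPow i (I 0)).eq]; rfl
    rw [tot_single, map_add, charPoly_single, charPoly_single, h0, h1, MIdx.sum_up, h2, pow_succ]
    module

theorem charPoly_apply {N n : ℕ} [NeZero n] (P : Poly N n) (J : Fin n → MIdx N) :
    charPoly P J = if J 0 = 0 then
      ∑ᶠ K : MIdx N, (-1 : ℝ) ^ (∑ i, K i) • dXPow K (P (Function.update J 0 K)) else 0 := by
  have hfin : ∀ P : Poly N n, (Function.support fun K : MIdx N =>
      (-1 : ℝ) ^ (∑ i, K i) • dXPow K (P (Function.update J 0 K))).Finite := by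
    intro P
    refine (P.support.finite_toSet.preimage
      (Function.update_injective J 0).injOn).subset fun K hK => ?_
    simp only [Set.mem_preimage, Finset.mem_coe, Finsupp.mem_support_iff]
    exact fun h => hK (by simp [h])
  induction P using Finsupp.induction_linear with
  | zero => simp
  | add P Q hP hQ =>
    rw [map_add, Finsupp.add_apply, hP, hQ]
    split_ifs
    · rw [← finsum_add_distrib (hfin P) (hfin Q)]
      exact finsum_congr fun K => by simp
    · rw [add_zero]
  | single I a =>
    rw [charPoly_single, Finsupp.smul_apply]
    by_cases hJ : J 0 = 0
    · rw [if_pos hJ, finsum_eq_single _ (I 0)]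
      · by_cases h : J = Function.update I 0 0
        · subst h; simp
        · have h' : Function.update J 0 (I 0) ≠ I := fun e => h (by
            rw [← e, Function.update_idem, ← hJ, Function.update_eq_self])
          rw [Finsupp.single_eq_of_ne h, Finsupp.single_eq_of_ne h', map_zero]
      · intro K hK
        have h' : Function.update J 0 K ≠ I := fun e => hK (by rw [← e]; simp)
        rw [Finsupp.single_eq_of_ne h', map_zero, smul_zero]
    · have h : J ≠ Function.update I 0 0 := fun e => hJ (by rw [e]; simp)
      rw [if_neg hJ, Finsupp.single_eq_of_ne h, smul_zero]

theorem charCoeff_eq {N n : ℕ} [NeZero n] (q : Coeff N n) : charCoeff q = liftC charPoly q :=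
  Subtype.ext (funext fun c => (charPoly_apply (slice c.2 q) c.1).symm)

theorem dYT_eq_dXT {N n : ℕ} [NeZero n] (I : Fin n → MIdx N) (hI : I 0 = 0) : dYT I = dXT I := by
  induction I using slotIdx_induction with
  | zero => rw [(dYT_isMonomialFamily N n).zero, (dXT_isMonomialFamily N n).zero]
  | add I j i ih =>
    have h0 := congrFun hI i
    simp only [Pi.add_apply, unitIdx_apply, Pi.zero_apply, Nat.add_eq_zero_iff] at h0
    have hj : j ≠ 0 := by rintro rfl; simp at h0
    have hI0 : I 0 = 0 := by simpa [unitIdx, hj.symm] using hI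
    rw [(dYT_isMonomialFamily N n).add, (dXT_isMonomialFamily N n).add, ih hI0, dYSlot, if_neg hj]

/-- The characteristic involves no `d/dy_1`, and the remaining `d/dy_j` are the `d/dx_j`. This
reconciles the non-polarized form in `chi` with polarized coefficients. -/
theorem xForm_charCoeff {N n : ℕ} [NeZero n] (q : Coeff N n) :
    xForm N n (charCoeff q) = yForm N n (charCoeff q) := by
  have h : ev dXT ∘ₗ charPoly (N := N) (n := n) = ev dYT ∘ₗ charPoly := by
    refine Finsupp.lhom_ext fun I a => LinearMap.ext fun t => ?_
    simp only [LinearMap.comp_apply, charPoly_single, map_smul, LinearMap.smul_apply, ev_single]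
    rw [dYT_eq_dXT _ (Function.update_self ..)]
  have h' := fun P => LinearMap.congr_fun h P
  simp only [LinearMap.comp_apply] at h'
  refine LinearMap.ext fun t => ?_
  simp only [charCoeff_eq, xForm, yForm, opSum_apply, slice_liftC, h']

/-- One integration by parts trades a factor `d/dyⁱ_1` for minus the derivative of the coefficient,
modulo the image of `tot i`; both sides have the same characteristic by `charPoly_tot`. The
primitives are linear in `a`, so that they can be assembled into linear maps. -/
theorem exists_sum_tot_single {N n : ℕ} [NeZero n] (I : Fin n → MIdx N) :
    ∃ b : Fin N → Loc N →ₗ[ℝ] Poly N n, ∀ a, Finsupp.single I a =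
      charPoly (Finsupp.single I a) + ∑ i, tot i (b i a) := by
  induction hd : ∑ i, I 0 i generalizing I with
  | zero =>
    have h0 : I 0 = 0 := funext (by simpa [Finset.sum_eq_zero_iff] using hd)
    refine ⟨0, fun a => ?_⟩
    rw [charPoly_single, h0, dXPow_zero, ← h0, Function.update_eq_self]
    simp [h0]
  | succ d ih =>
    obtain ⟨i, hi⟩ : ∃ i, I 0 i ≠ 0 := by
      by_contra! h0
      simp [h0] at hd
    obtain ⟨K, rfl⟩ : ∃ K, I = K + unitIdx 0 i := ⟨_, (sub_add_unitIdx hi).symm⟩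
    obtain ⟨b, hb⟩ := ih K (by
      simp only [Pi.add_apply, Finset.sum_add_distrib, unitIdx_apply] at hd
      simpa using hd)
    -- The component `i` receives the monomial whose total derivative was split off; the rest are
    -- the primitives of the lower term, with sign `-1`.
    refine ⟨fun l => (if l = i then Finsupp.lsingle K else 0) + (-1 : ℝ) • (b l ∘ₗ dX i),
      fun a => ?_⟩
    have h1 := tot_single i K a
    have h2 := charPoly_tot i (Finsupp.single K a)
    have h4 := hb (dX i a)
    have h3 : ∑ l, tot l ((if l = i then Finsupp.lsingle (R := ℝ) K else 0) a) =
        tot i (Finsupp.single K a) := by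
      rw [Finset.sum_eq_single i]
      · simp
      · intro l _ hl; simp [hl]
      · simp
    simp only [LinearMap.add_apply, LinearMap.smul_apply, LinearMap.comp_apply, map_add, map_smul,
      Finset.sum_add_distrib, h3, ← Finset.smul_sum]
    rw [h1, map_add] at h2
    rw [h1]
    generalize Finsupp.single (K + unitIdx 0 i) a = x at *
    generalize Finsupp.single K (dX i a) = y at *
    generalize ∑ l, tot l (b l (dX i a)) = z at *
    calc x = x + (y + (-1 : ℝ) • y) := by module
      _ = x + (y + (-1 : ℝ) • (charPoly y + z)) := by rw [← h4]
      _ = (x + y + (-1 : ℝ) • z) + (-1 : ℝ) • charPoly y := by module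
      _ = (x + y + (-1 : ℝ) • z) + ((-1 : ℝ) • charPoly y + (charPoly x + charPoly y)) := by
        rw [h2, add_zero]
      _ = _ := by module

/-- Linearity of the `s i` is essential: it allows them to be lifted to coefficient systems, where
infinitely many `α` may occur. -/
theorem exists_sum_tot (N n : ℕ) [NeZero n] :
    ∃ s : Fin N → Poly N n →ₗ[ℝ] Poly N n, ∀ P, P = charPoly P + ∑ i, tot i (s i P) := by
  choose b hb using exists_sum_tot_single (N := N) (n := n)
  refine ⟨fun i => Finsupp.lsum ℝ fun I => b I i, fun P => ?_⟩
  induction P using Finsupp.induction_linear with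
  | zero => simp
  | add P Q hP hQ =>
    simp only [map_add, Finset.sum_add_distrib]
    nth_rewrite 1 [hP, hQ]
    exact add_add_add_comm _ _ _ _
  | single I a => simpa using hb I a

/-! ### The Koszul homotopy for operators with canonical commutation relations -/

section Koszul

variable {N : ℕ} {V : Type*} [AddCommGroup V] [Module ℝ V]

/-- The Koszul differential of operators `T_i`, on forms with components indexed by sets. -/
def koszulD (T : Fin N → V →ₗ[ℝ] V) (W : Finset (Fin N) → V) (S : Finset (Fin N)) : V :=
  ∑ i ∈ S, wedgeSign S i • T i (W (S.erase i))

/-- The contraction with operators `δ_i`. -/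
def koszulH (δ : Fin N → V →ₗ[ℝ] V) (W : Finset (Fin N) → V) (S : Finset (Fin N)) : V :=
  ∑ i ∈ Sᶜ, wedgeSign (insert i S) i • δ i (W (insert i S))

theorem wedgeSign_mul_self (S : Finset (Fin N)) (i : Fin N) :
    wedgeSign S i * wedgeSign S i = 1 := by
  unfold wedgeSign
  rw [← mul_pow]
  norm_num

theorem wedgeSign_insert {S : Finset (Fin N)} {i j : Fin N} (hi : i ∈ S) (hj : j ∉ S) :
    wedgeSign S i * wedgeSign (insert j (S.erase i)) j =
      -(wedgeSign (insert j S) j * wedgeSign (insert j S) i) := by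
  have hij : i ≠ j := fun h => hj (h ▸ hi)
  have h := wedgeSign_swap (Finset.mem_insert_of_mem (b := j) hi) (Finset.mem_insert_self j S) hij
  rw [Finset.erase_insert hj, Finset.erase_insert_of_ne hij.symm] at h
  have h1 := wedgeSign_mul_self (insert j S) i
  have h2 := wedgeSign_mul_self (insert j S) j
  have h3 := wedgeSign_mul_self S i
  generalize wedgeSign (insert j S) i = a at *
  generalize wedgeSign (insert j S) j = b at *
  generalize wedgeSign S i = c at *
  generalize wedgeSign (insert j (S.erase i)) j = d at *
  -- The relation `a d = -b c` is multiplied by `c a`, and squares of signs are replaced by `1`.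
  linear_combination c * a * h - c * d * h1 - a * b * h3

/-- Removing `i ∈ S` and adding `j ∉ S` in either order gives mixed terms of opposite sign, which
cancel. The diagonal terms are `T_i δ_i` for `i ∈ S` and `δ_j T_j = T_j δ_j + 1` for `j ∉ S`; the
extra identities number `N - |S|`. -/
theorem koszul_homotopy {T δ : Fin N → V →ₗ[ℝ] V}
    (hδ : ∀ i l v, δ l (T i v) = T i (δ l v) + if i = l then v else 0)
    (W : Finset (Fin N) → V) (S : Finset (Fin N)) :
    koszulD T (koszulH δ W) S + koszulH δ (koszulD T W) S =
      ((N : ℝ) - S.card) • W S + ∑ i, T i (δ i (W S)) := by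
  let F : Fin N → Fin N → V := fun i j =>
    (wedgeSign S i * wedgeSign (insert j (S.erase i)) j) • T i (δ j (W (insert j (S.erase i))))
  have h1 : koszulD T (koszulH δ W) S =
      ∑ i ∈ S, T i (δ i (W S)) + ∑ i ∈ S, ∑ j ∈ Sᶜ, F i j := by
    rw [koszulD, ← Finset.sum_add_distrib]
    refine Finset.sum_congr rfl fun i hi => ?_
    have hc : (S.erase i)ᶜ = insert i Sᶜ := Finset.compl_erase
    rw [koszulH, hc, Finset.sum_insert (by simpa using hi), Finset.insert_erase hi, map_add,
      smul_add, map_smul, smul_smul, wedgeSign_mul_self, one_smul, map_sum, Finset.smul_sum]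
    congr 1
    exact Finset.sum_congr rfl fun j _ => by rw [map_smul, smul_smul]
  have h2 : koszulH δ (koszulD T W) S =
      ∑ j ∈ Sᶜ, (T j (δ j (W S)) + W S) + ∑ j ∈ Sᶜ, ∑ i ∈ S, -F i j := by
    rw [koszulH, ← Finset.sum_add_distrib]
    refine Finset.sum_congr rfl fun j hj => ?_
    have hj : j ∉ S := by simpa using hj
    rw [koszulD, Finset.sum_insert hj, Finset.erase_insert hj, map_add, smul_add, map_smul,
      smul_smul, wedgeSign_mul_self, one_smul, hδ, if_pos rfl, map_sum, Finset.smul_sum]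
    congr 1
    refine Finset.sum_congr rfl fun i hi => ?_
    have hij : i ≠ j := fun h => hj (h ▸ hi)
    rw [map_smul, smul_smul, hδ, if_neg hij, add_zero, Finset.erase_insert_of_ne hij.symm]
    simp only [F]
    rw [wedgeSign_insert hi hj, neg_smul, neg_neg]
  have hcard : ((Sᶜ.card : ℕ) : ℝ) = (N : ℝ) - S.card := by
    rw [Finset.card_compl, Fintype.card_fin, Nat.cast_sub (by simpa using S.card_le_univ)]
  rw [h1, h2, Finset.sum_comm (s := S), ← Finset.sum_add_sum_compl S, Finset.sum_add_distrib,
    Finset.sum_const, ← Nat.cast_smul_eq_nsmul ℝ, hcard]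
  simp only [Finset.sum_neg_distrib]
  abel

theorem koszul_homotopy_of_cocycle {T δ : Fin N → V →ₗ[ℝ] V}
    (hδ : ∀ i l v, δ l (T i v) = T i (δ l v) + if i = l then v else 0)
    {W : Finset (Fin N) → V} (hW : ∀ S, koszulD T W S = 0) (S : Finset (Fin N)) :
    koszulD T (koszulH δ W) S = ((N : ℝ) - S.card) • W S + ∑ i, T i (δ i (W S)) := by
  have h : koszulH δ (koszulD T W) S = 0 :=
    Finset.sum_eq_zero fun i _ => by rw [hW, map_zero, smul_zero]
  rw [← koszul_homotopy hδ, h, add_zero]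

end Koszul

/-! ### Transfer from polynomials to operators -/

variable {N n : ℕ}

/-- Local differential operators correspond to their polarized coefficients. -/
def yEquiv (N n : ℕ) [NeZero n] : Coeff N n ≃ₗ[ℝ] LDO N n :=
  LinearEquiv.ofBijective ((yForm N n).codRestrict (LDO N n) fun q => by
    rw [← range_yForm]; exact ⟨q, rfl⟩) ⟨fun _ _ h => yForm_injective N n (congrArg Subtype.val h),
      fun A => by
        obtain ⟨q, hq⟩ := (range_yForm N n).ge A.2
        exact ⟨q, Subtype.ext hq⟩⟩

/-- The linear map on operators that is given by a linear map on polynomials. -/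
def opLift [NeZero n] (θ : Poly N n →ₗ[ℝ] Poly N n) : LDO N n →ₗ[ℝ] LDO N n :=
  (yEquiv N n).toLinearMap ∘ₗ liftC θ ∘ₗ (yEquiv N n).symm.toLinearMap

theorem opLift_yEquiv [NeZero n] (θ : Poly N n →ₗ[ℝ] Poly N n) (q : Coeff N n) :
    opLift θ (yEquiv N n q) = yEquiv N n (liftC θ q) := by
  simp [opLift]

theorem opLift_tot [NeZero n] (i : Fin N) (A : LDO N n) : opLift (tot i) A = postD i A := by
  obtain ⟨q, rfl⟩ := (yEquiv N n).surjective A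
  rw [opLift_yEquiv]
  exact Subtype.ext (yForm_tot i q)

theorem opLift_comp [NeZero n] (θ η : Poly N n →ₗ[ℝ] Poly N n) (A : LDO N n) :
    opLift (θ ∘ₗ η) A = opLift θ (opLift η A) := by
  obtain ⟨q, rfl⟩ := (yEquiv N n).surjective A
  simp only [opLift_yEquiv, liftC_comp]

theorem opLift_add [NeZero n] (θ η : Poly N n →ₗ[ℝ] Poly N n) (A : LDO N n) :
    opLift (θ + η) A = opLift θ A + opLift η A := by
  simp [opLift]

theorem opLift_zero [NeZero n] (A : LDO N n) : opLift 0 A = 0 := by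
  simp [opLift]

theorem opLift_smul [NeZero n] (c : ℝ) (θ : Poly N n →ₗ[ℝ] Poly N n) (A : LDO N n) :
    opLift (c • θ) A = c • opLift θ A := by
  simp [opLift]

theorem opLift_sum [NeZero n] {ι : Type*} (s : Finset ι) (θ : ι → Poly N n →ₗ[ℝ] Poly N n)
    (A : LDO N n) : opLift (∑ i ∈ s, θ i) A = ∑ i ∈ s, opLift (θ i) A := by
  classical
  induction s using Finset.induction_on with
  | empty => exact opLift_zero A
  | insert a s ha ih => rw [Finset.sum_insert ha, Finset.sum_insert ha, opLift_add, ih]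

theorem opLift_id [NeZero n] (A : LDO N n) : opLift LinearMap.id A = A := by
  obtain ⟨q, rfl⟩ := (yEquiv N n).surjective A
  rw [opLift_yEquiv, liftC_id]

theorem opLift_del_postD [NeZero n] (i l : Fin N) (A : LDO N n) :
    opLift (del 0 l) (postD i A) = postD i (opLift (del 0 l) A) + if i = l then A else 0 := by
  rw [← opLift_tot, ← opLift_tot, ← opLift_comp, ← opLift_comp]
  have h : (del 0 l ∘ₗ tot i : Poly N n →ₗ[ℝ] Poly N n) =
      tot i ∘ₗ del 0 l + if i = l then LinearMap.id else 0 := by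
    refine LinearMap.ext fun P => ?_
    rw [LinearMap.comp_apply, del_tot]
    split_ifs <;> rfl
  rw [h, opLift_add]
  congr 1
  split_ifs
  · exact opLift_id A
  · exact opLift_zero A

theorem opLift_eulerOp [NeZero n] (c : ℝ) (A : LDO N n) :
    opLift (eulerOp c) A = c • A + ∑ i, postD i (opLift (del 0 i) A) := by
  rw [eulerOp, opLift_add, opLift_sum, opLift_smul, opLift_id]
  exact congrArg _ (Finset.sum_congr rfl fun i _ => by rw [opLift_comp, opLift_tot])

/-- Lifting respects composition and identity, so the inverse lifts too. -/
theorem opLift_bijective [NeZero n] {θ : Poly N n →ₗ[ℝ] Poly N n} (h : Function.Bijective θ) :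
    Function.Bijective (opLift θ) := by
  let e := LinearEquiv.ofBijective θ h
  have h1 : θ ∘ₗ e.symm.toLinearMap = LinearMap.id := LinearMap.ext e.apply_symm_apply
  have h2 : e.symm.toLinearMap ∘ₗ θ = LinearMap.id := LinearMap.ext e.symm_apply_apply
  refine Function.bijective_iff_has_inverse.2 ⟨opLift e.symm.toLinearMap, fun A => ?_, fun A => ?_⟩
  · rw [← opLift_comp, h2, opLift_id]
  · rw [← opLift_comp, h1, opLift_id]

theorem opLift_eulerOp_bijective [NeZero n] {c : ℝ} (hc : 0 < c) :
    Function.Bijective (opLift (N := N) (n := n) (eulerOp c)) :=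
  opLift_bijective ⟨eulerOp_injective hc, eulerOp_surjective hc⟩

/-! ### Vanishing of the cohomology below the top degree -/

/-- The extension of the components of a form by zero. -/
def extendForm {k : ℕ} (θ : OForm N n k) (S : Finset (Fin N)) : LDO N n :=
  if h : S.card = k then θ ⟨S, h⟩ else 0

theorem extendForm_of_ne {k : ℕ} (θ : OForm N n k) {S : Finset (Fin N)} (h : S.card ≠ k) :
    extendForm θ S = 0 := dif_neg h

theorem extendForm_coe {k : ℕ} (θ : OForm N n k) (S : {S : Finset (Fin N) // S.card = k}) :
    extendForm θ S.1 = θ S := dif_pos S.2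

theorem opD_apply {k : ℕ} (θ : OForm N n k) (S : {S : Finset (Fin N) // S.card = k + 1}) :
    opD N n k θ S = koszulD postD (extendForm θ) S.1 := by
  rw [koszulD, ← Finset.sum_attach]
  exact Finset.sum_congr rfl fun i _ =>
    congrArg (fun A => wedgeSign S.1 i.1 • postD i.1 A) (extendForm_coe θ ⟨_, _⟩).symm

theorem extendForm_opD {k : ℕ} (θ : OForm N n k) :
    extendForm (opD N n k θ) = koszulD postD (extendForm θ) := by
  funext S
  by_cases h : S.card = k + 1
  · exact (extendForm_coe _ ⟨S, h⟩).trans (opD_apply θ ⟨S, h⟩)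
  · rw [extendForm_of_ne _ h, koszulD, Finset.sum_eq_zero]
    intro i hi
    rw [extendForm_of_ne, map_zero, smul_zero]
    rw [Finset.card_erase_of_mem hi]
    have := Finset.card_pos.2 ⟨i, hi⟩
    omega

/-- On a cocycle one half of the homotopy formula drops out. What remains exhibits the Euler
operator applied to the form as the differential of its contraction. -/
theorem euler_of_cocycle [NeZero n] {k : ℕ} {θ : OForm N n k} (hθ : opD N n k θ = 0)
    (S : Finset (Fin N)) :
    koszulD postD (koszulH (fun i => opLift (del 0 i)) (extendForm θ)) S =
      opLift (eulerOp ((N : ℝ) - S.card)) (extendForm θ S) := by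
  have h0 : ∀ S, koszulD postD (extendForm θ) S = 0 := fun S => by
    rw [← extendForm_opD, hθ]
    unfold extendForm
    split_ifs <;> rfl
  exact (koszul_homotopy_of_cocycle (fun i l => opLift_del_postD i l) h0 S).trans
    (opLift_eulerOp _ _).symm

/-- The shift by one is the commutator of `∂/∂(d/dyⁱ_1)` with `d/dxⁱ`. It matches the growth of `N -
|S|` when an index is removed from `S`, so inverses of Euler operators can be moved through the
differential. -/
theorem opLift_eulerOp_postD [NeZero n] (c : ℝ) (i : Fin N) (A : LDO N n) :
    opLift (eulerOp c) (postD i A) = postD i (opLift (eulerOp (c + 1)) A) := by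
  rw [opLift_eulerOp, opLift_eulerOp]
  simp only [opLift_del_postD, map_add, map_sum, map_smul, Finset.sum_add_distrib]
  have h : ∑ l, postD l (if i = l then A else 0) = postD i A := by
    rw [Finset.sum_eq_single i]
    · simp
    · intro l _ hl; simp [hl.symm]
    · simp
  rw [h, add_smul, one_smul]
  simp only [postD_comm i]
  abel

theorem cocycles_le_coboundaries [NeZero n] {k : ℕ} (hk : k < N) :
    cocycles N n k ≤ coboundaries N n k := by
  intro θ hθ
  have hθ : opD N n k θ = 0 := hθ
  have hE := euler_of_cocycle hθ
  cases k with
  | zero =>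
    change θ = 0
    funext S
    have hS : S.1 = ∅ := Finset.card_eq_zero.1 S.2
    have h := hE S.1
    rw [extendForm_coe, hS] at h
    refine (opLift_eulerOp_bijective (c := (N : ℝ) - (∅ : Finset (Fin N)).card) ?_).1
      (h.symm.trans ?_)
    · simpa using hk
    -- In degree `0` the homotopy formula has an empty sum on its left, so the Euler operator
    -- annihilates the form.
    · rw [koszulD, Finset.sum_empty]
      exact (map_zero _).symm
  | succ k =>
    let c : ℝ := (N : ℝ) - (k + 1 : ℕ)
    have hc : 0 < c := sub_pos.2 (by exact_mod_cast hk)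
    -- The primitive is `E_{c+1}⁻¹ h θ`; the constant is `c + 1` because `η` has one degree less
    -- than `θ`.
    choose η hη using fun S : {S : Finset (Fin N) // S.card = k} =>
      (opLift_eulerOp_bijective (N := N) (n := n) (c := c + 1) (by linarith)).2
        (koszulH (fun i => opLift (del 0 i)) (extendForm θ) S.1)
    refine ⟨η, ?_⟩
    funext S
    refine (opLift_eulerOp_bijective hc).1 ?_
    have h := hE S.1
    rw [extendForm_coe, S.2] at h
    rw [← h, opD_apply, koszulD, koszulD, map_sum]
    refine Finset.sum_congr rfl fun i hi => ?_
    have hcard : (S.1.erase i).card = k := by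
      rw [Finset.card_erase_of_mem hi, S.2, Nat.add_sub_cancel]
    rw [map_smul, opLift_eulerOp_postD]
    exact congrArg (fun v => wedgeSign S.1 i • postD i v)
      ((congrArg _ (extendForm_coe η ⟨_, hcard⟩)).trans (hη ⟨_, hcard⟩))

/-- The commutation relation forces each `d/dxⁱ ∘ δ_i A` to be `-A`, so the Euler operator with
constant `N` gives `N A - N A = 0`, and it is injective since `N > 0`. -/
theorem eq_zero_of_postD [NeZero n] (hN : 1 ≤ N) {A : LDO N n} (hA : ∀ i, postD i A = 0) :
    A = 0 := by
  refine (opLift_eulerOp_bijective (c := (N : ℝ)) (by exact_mod_cast hN)).1 ?_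
  rw [map_zero, opLift_eulerOp]
  have h : ∀ i, postD i (opLift (del 0 i) A) = -A := fun i => by
    have := opLift_del_postD i i A
    rw [hA, map_zero, if_pos rfl] at this
    exact eq_neg_of_add_eq_zero_left this.symm
  simp only [h, Finset.sum_const, Finset.card_univ, Fintype.card_fin]
  rw [← Nat.cast_smul_eq_nsmul ℝ, smul_neg, add_neg_cancel]

/-! ### The characteristic and the top cohomology -/

theorem chi_eq_zero_iff [NeZero n] (A : LDO N n) : chi A = 0 ↔ opLift charPoly A = 0 := by
  obtain ⟨q, rfl⟩ := (yEquiv N n).surjective A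
  have h : ∃ q' : Coeff N n, yForm N n q' = yEquiv N n q := ⟨q, rfl⟩
  -- Uniqueness of the polarized form makes the choice in `chi` harmless.
  have hq : h.choose = q := yForm_injective N n h.choose_spec
  have e : (chi (yEquiv N n q)).1 = yForm N n (charCoeff q) := by
    rw [← xForm_charCoeff, chi, dif_pos h]
    exact congrArg (fun q' => xForm N n (charCoeff q')) hq
  have e' : chi (yEquiv N n q) = yEquiv N n (charCoeff q) := Subtype.ext e
  rw [opLift_yEquiv, e', charCoeff_eq]

/-- The total derivatives of families of operators. -/
def sumPostD (N n : ℕ) : (Fin N → LDO N n) →ₗ[ℝ] LDO N n :=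
  ∑ i, postD i ∘ₗ LinearMap.proj i

theorem sumPostD_apply (B : Fin N → LDO N n) : sumPostD N n B = ∑ i, postD i (B i) := by
  simp [sumPostD]

theorem opLift_charPoly_sumPostD [NeZero n] (B : Fin N → LDO N n) :
    opLift charPoly (sumPostD N n B) = 0 := by
  have h : ∀ i, (charPoly ∘ₗ tot i : Poly N n →ₗ[ℝ] Poly N n) = 0 := fun i =>
    LinearMap.ext (charPoly_tot i)
  rw [sumPostD_apply, map_sum]
  refine Finset.sum_eq_zero fun i _ => ?_
  rw [← opLift_tot, ← opLift_comp, h, opLift_zero]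

/-- Total derivatives have zero characteristic; conversely `exists_sum_tot` writes an operator as
its characteristic plus total derivatives. -/
theorem ker_charPoly [NeZero n] :
    LinearMap.ker (opLift (N := N) (n := n) charPoly) = LinearMap.range (sumPostD N n) := by
  obtain ⟨s, hs⟩ := exists_sum_tot N n
  ext A
  constructor
  · intro hA
    refine ⟨fun i => opLift (s i) A, ?_⟩
    have h : (LinearMap.id : Poly N n →ₗ[ℝ] Poly N n) = charPoly + ∑ i, tot i ∘ₗ s i :=
      LinearMap.ext fun P => by simpa using hs P
    have hA : opLift charPoly A = 0 := hA
    have h2 := opLift_id A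
    rw [h, opLift_add, hA, zero_add] at h2
    rw [opLift_sum] at h2
    rw [sumPostD_apply]
    refine Eq.trans ?_ h2
    exact Finset.sum_congr rfl fun i _ => by rw [opLift_comp, opLift_tot]
  · rintro ⟨B, rfl⟩
    exact opLift_charPoly_sumPostD B

theorem topCoeff_opD (k : ℕ) (η : OForm (k + 1) n k) :
    topCoeff (k + 1) n (opD (k + 1) n k η) =
      ∑ i, postD i (wedgeSign Finset.univ i • extendForm η (Finset.univ.erase i)) := by
  refine (opD_apply η ⟨Finset.univ, Finset.card_fin _⟩).trans ?_
  rw [koszulD]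
  exact Finset.sum_congr rfl fun i _ => (map_smul _ _ _).symm

theorem topCoeff_injective (N n : ℕ) : Function.Injective (topCoeff N n) := by
  intro θ η h
  funext S
  have hS : S = ⟨Finset.univ, Finset.card_fin N⟩ :=
    Subtype.ext ((Finset.card_eq_iff_eq_univ S.1).1 (by rw [S.2, Fintype.card_fin]))
  rw [hS]
  exact h

/-- A form of degree `N - 1` amounts to an `N`-tuple of operators, indexed by the missing `dxⁱ`, and
its differential is their divergence up to signs. -/
theorem mem_coboundaries_top (hN : 1 ≤ N) (θ : OForm N n N) :
    θ ∈ coboundaries N n N ↔ topCoeff N n θ ∈ LinearMap.range (sumPostD N n) := by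
  obtain ⟨k, rfl⟩ := Nat.exists_eq_add_of_le' hN
  constructor
  · rintro ⟨η, rfl⟩
    exact ⟨_, (sumPostD_apply _).trans (topCoeff_opD k η).symm⟩
  · rintro ⟨B, hB⟩
    have hex : ∀ S : {S : Finset (Fin (k + 1)) // S.card = k}, ∃ i, S.1 = Finset.univ.erase i := by
      intro S
      have h1 : (S.1)ᶜ.card = 1 := by rw [Finset.card_compl, Fintype.card_fin, S.2]; omega
      obtain ⟨i, hi⟩ := Finset.card_eq_one.1 h1
      exact ⟨i, by rw [← compl_compl S.1, hi, Finset.compl_singleton]⟩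
    choose v hv using hex
    -- The sign cancels the one in the differential, since its square is `1`.
    refine ⟨fun S => wedgeSign Finset.univ (v S) • B (v S), topCoeff_injective _ _ ?_⟩
    rw [topCoeff_opD, ← hB, sumPostD_apply]
    refine Finset.sum_congr rfl fun i _ => congrArg _ ?_
    have hcard : (Finset.univ.erase i).card = k := by
      rw [Finset.card_erase_of_mem (Finset.mem_univ i), Finset.card_fin, Nat.add_sub_cancel]
    have hi : v ⟨_, hcard⟩ = i := by
      by_contra h
      have h1 : Finset.univ.erase i = _ := hv ⟨_, hcard⟩
      have h2 : v ⟨_, hcard⟩ ∈ Finset.univ.erase i := Finset.mem_erase.2 ⟨h, Finset.mem_univ _⟩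
      exact Finset.notMem_erase _ _ (h1.le h2)
    rw [extendForm, dif_pos hcard, hi, smul_smul, wedgeSign_mul_self, one_smul]

/-- In degree `N` every form is a cocycle, so that cocycles correspond to operators. -/
def topEquiv (N n : ℕ) : cocycles N n N ≃ₗ[ℝ] LDO N n :=
  LinearEquiv.ofBijective (topCoeff N n ∘ₗ (cocycles N n N).subtype)
    ⟨fun _ _ h => Subtype.ext (topCoeff_injective N n h), fun A =>
      ⟨⟨fun _ => A, by
        refine funext fun S => absurd S.2 (ne_of_lt ?_)
        have := S.1.card_le_univ
        rw [Fintype.card_fin] at this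
        omega⟩, rfl⟩⟩

theorem map_topEquiv (hN : 1 ≤ N) :
    ((coboundaries N n N).submoduleOf (cocycles N n N)).map (topEquiv N n).toLinearMap =
      LinearMap.range (sumPostD N n) := by
  ext A
  constructor
  · rintro ⟨z, hz, rfl⟩
    exact (mem_coboundaries_top hN z.1).1 hz
  · intro hA
    obtain ⟨z, rfl⟩ := (topEquiv N n).surjective A
    exact ⟨z, (mem_coboundaries_top hN z.1).2 hA, rfl⟩

end OpComplex

end

theorem theorem5p2 (N n : ℕ) (hN : 1 ≤ N) [NeZero n] :
    (∀ A : OpComplex.LDO N n, ∃! q : OpComplex.Coeff N n, OpComplex.yForm N n q = A) ∧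
    (∀ k < N, Subsingleton (OpComplex.cohomology N n k)) ∧
    (∃ K : Submodule ℝ (OpComplex.LDO N n), (∀ A, A ∈ K ↔ OpComplex.chi A = 0) ∧
      ∃ e : OpComplex.cohomology N n N ≃ₗ[ℝ] (OpComplex.LDO N n ⧸ K),
        ∀ z : OpComplex.cocycles N n N,
          e (Submodule.Quotient.mk z) = Submodule.Quotient.mk (OpComplex.topCoeff N n z)) ∧
    (∀ A : OpComplex.LDO N n, (∀ i : Fin N, OpComplex.dX i ∘ₗ A.1 = 0) → A = 0) := by
  open OpComplex in
  -- The subspace is taken as the image of the total derivatives, which is linear by construction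
  -- and matches the coboundaries; `ker_charPoly` identifies it with the zeros of `chi`.
  refine ⟨fun A => ?_, fun k hk => ?_, ⟨LinearMap.range (sumPostD N n), fun A => ?_, ?_⟩,
    fun A hA => eq_zero_of_postD hN fun i => Subtype.ext (hA i)⟩
  · obtain ⟨q, hq⟩ := (range_yForm N n).ge A.2
    exact ⟨q, hq, fun q' hq' => yForm_injective N n (hq'.trans hq.symm)⟩
  · refine Submodule.Quotient.subsingleton_iff.2 ?_
    exact eq_top_iff.2 fun z _ => cocycles_le_coboundaries hk z.2
  · rw [chi_eq_zero_iff, ← ker_charPoly, LinearMap.mem_ker]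
  · exact ⟨Submodule.Quotient.equiv _ _ (topEquiv N n) (map_topEquiv hN), fun z => rfl⟩
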